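/- **Setting.** Let $\mathcal O\subset\mathbb R^2$ be a bounded open set and let $\nu,\sigma>0$. Let $\mathcal V$ be the space of divergence-free fields in $C_0^\infty(\mathcal O;\mathbb R^2)$, let $\mathbb H$ be its closure in $L^2(\mathcal O;\mathbb R^2)$ (with the $L^2$ norm), and let $\mathbb V$ be its completion in the $H^1_0(\mathcal O;\mathbb R^2)$ norm. For $u,v,w\in\mathbb V$ put $$\langle \mathrm Au,w\rangle=\int_{\mathcal O}\nabla u:\nabla w\,dx,\qquad \langle \mathrm B(u),w\rangle=b(u,u,w),\qquad b(u,v,w)=\sum_{i,j=1}^2\int_{\mathcal O}u_i\,\frac{\partial v_j}{\partial x_i}\,w_j\,dx .$$ Let $\Omega=\{\omega\in C(\mathbb R;\mathbb R):\omega(0)=0\}$ with the compact-open topology and its Borel $\sigma$-algebra, let $\mathbb P$ be the two-sided Wiener measure on $\Omega$, and let $\theta_t\omega(\cdot)=\omega(\cdot+t)-\omega(t)$. Let $$\widetilde\Omega=\Big\{\omega\in\Omega:\int_{-\infty}^0e^{\sigma s}|\omega(s)|\,ds<\infty\Big\},\qquad z(\omega)=\int_{-\infty}^0e^{\sigma s}\,d\omega(s):=-\sigma\int_{-\infty}^0e^{\sigma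 s}\omega(s)\,ds\quad(\omega\in\widetilde\Omega),$$ so that $t\mapsto z(\theta_t\omega)$ is the stationary Ornstein–Uhlenbeck process $dz+\sigma z\,dt=d\mathrm W$. For $g\in L^2_{\rm loc}(\mathbb R;\mathbb H)$, $\tau\in\mathbb R$, $\omega\in\widetilde\Omega$ and $v_0\in\mathbb H$, a *weak solution* on $[\tau,\infty)$ of $$\frac{dv}{dt}+\nu \mathrm Av+e^{z(\theta_t\omega)}\mathrm B(v)=e^{-z(\theta_t\omega)}g(t)+\sigma z(\theta_t\omega)v,\qquad v(\tau)=v_0,\tag{1}$$ is a function $v\in C([\tau,\infty);\mathbb H)\cap L^2_{\rm loc}([\tau,\infty);\mathbb V)$ with $v(\tau)=v_0$ such that for all $w\in\mathbb V$ and $t\ge\tau$ $$(v(t),w)=(v_0,w)+\int_\tau^t\Big[-\nu\langle \mathrm Av(s),w\rangle-e^{z(\theta_s\omega)}\langle \mathrm B(v(s)),w\rangle+e^{-z(\theta_s\omega)}(g(s),w)+\sigma z(\theta_s\omega)(v(s),w)\Big]ds,$$ where $(\cdot,\cdot)$ is the inner product of $L^2(\mathcal O;\mathbb R^2)$. **Proposition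 3.4.** Let $f\in L^2_{\rm loc}(\mathbb R;\mathbb H)$ and $f_\infty\in\mathbb H$ be such that $$\lim_{\tau\to-\infty}\int_{-\infty}^{\tau}\|f(t)-f_\infty\|_{\mathbb H}^2\,dt=0 .$$ Then $\widetilde\Omega$ satisfies $\mathbb P(\widetilde\Omega)=1$ and $\theta_t\widetilde\Omega\subset\widetilde\Omega$ for all $t\in\mathbb R$, and the following holds for every $\omega\in\widetilde\Omega$. Let $(v_\tau)_{\tau\in\mathbb R}$ in $\mathbb H$ and $\widetilde v_0\in\mathbb H$ satisfy $\|v_\tau-\widetilde v_0\|_{\mathbb H}\to0$ as $\tau\to-\infty$. For each $\tau\in\mathbb R$ let $v(\cdot,\tau,\theta_{-\tau}\omega,v_\tau)$ be a weak solution of (1) on $[\tau,\infty)$ with $g=f$, path $\theta_{-\tau}\omega$ and initial value $v_\tau$ at time $\tau$, and let $\widetilde v(\cdot,\omega,\widetilde v_0)$ be a weak solution of (1) on $[0,\infty)$ with $g\equiv f_\infty$, path $\omega$ and initial value $\widetilde v_0$ at time $0$. Then $$\lim_{\tau\to-\infty}\big\|v(T+\tau,\tau,\theta_{-\tau}\omega,v_\tau)-\widetilde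 v(T,\omega,\widetilde v_0)\big\|_{\mathbb H}=0\qquad\text{for all }T>0 .$$ -/

import Mathlib

open Set Filter Topology MeasureTheory
open ProbabilityTheory (HasLaw HasIndepIncrements gaussianReal)
open scoped ENNReal NNReal

noncomputable section

/-! ### Two-sided Wiener paths, the Wiener shift and the Ornstein-Uhlenbeck process -/

/-- The path space `{ω ∈ C(ℝ; ℝ) : ω(0) = 0}` with the compact-open topology. -/
abbrev WienerPath : Type := {ω : C(ℝ, ℝ) // ω 0 = 0}

/-- The Borel sigma-algebra of the compact-open topology. -/
instance instMeasurableSpaceWienerPath : MeasurableSpace WienerPath := borel WienerPath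

instance instBorelSpaceWienerPath : BorelSpace WienerPath := ⟨rfl⟩

/-- The Wiener shift `(θ_t ω)(s) = ω(s + t) - ω(t)`. -/
def wienerShift (t : ℝ) (ω : WienerPath) : WienerPath :=
  ⟨⟨fun s => ω.1 (s + t) - ω.1 t, by fun_prop⟩, by simp⟩

/-- The two-sided Wiener measure on path space: under `P` the coordinate process is a
two-sided standard Brownian motion. -/
structure IsTwoSidedWienerMeasure (P : Measure WienerPath) : Prop where
  isProbabilityMeasure : IsProbabilityMeasure P
  hasIndepIncrements : HasIndepIncrements (fun (t : ℝ) (ω : WienerPath) => ω.1 t) P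
  hasLaw_increment : ∀ s t : ℝ,
    HasLaw (fun ω : WienerPath => ω.1 t - ω.1 s) (gaussianReal 0 (nndist s t)) P

/-- The paths for which the Ornstein-Uhlenbeck integral below converges absolutely,
`∫_{-∞}^0 e^{σ s} |ω(s)| ds < ∞`. -/
def ouPaths (σ : ℝ) : Set WienerPath :=
  {ω | IntegrableOn (fun s : ℝ => Real.exp (σ * s) * ω.1 s) (Iic 0)}

/-- The pathwise Ornstein-Uhlenbeck variable `z(ω) = ∫_{-∞}^0 e^{σ s} dω(s)`, where the integral
against the path is defined through integration by parts:
`z(ω) = -σ ∫_{-∞}^0 e^{σ s} ω(s) ds`. The process is `t ↦ z(θ_t ω)`. -/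
def ouVariable (σ : ℝ) (ω : WienerPath) : ℝ :=
  -σ * ∫ s in Iic (0 : ℝ), Real.exp (σ * s) * ω.1 s

/-! ### The spaces of the planar Navier-Stokes equations -/

/-- The plane with its Euclidean norm. -/
abbrev Plane : Type := EuclideanSpace ℝ (Fin 2)

/-- The partial derivative `∂_i φ_j (x)`. -/
def planePartial (φ : Plane → Plane) (i j : Fin 2) (x : Plane) : ℝ :=
  fderiv ℝ φ x (EuclideanSpace.single i 1) j

/-- The gradient of a field, as the vector of its entries `(i, j) ↦ ∂_i φ_j (x)` with the
Frobenius norm. -/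
def planeGrad (φ : Plane → Plane) (x : Plane) : EuclideanSpace ℝ (Fin 2 × Fin 2) :=
  WithLp.toLp 2 fun p => planePartial φ p.1 p.2 x

/-- `𝒱`: the divergence-free fields in `C_0^∞(𝒪; ℝ²)`. -/
def divFreeTestFields (𝒪 : Set Plane) : Set (Plane → Plane) :=
  {φ | ContDiff ℝ ((⊤ : ℕ∞) : WithTop ℕ∞) φ ∧ HasCompactSupport φ ∧ tsupport φ ⊆ 𝒪 ∧
    ∀ x, ∑ i, planePartial φ i i x = 0}

/-- `L²(𝒪; ℝ²)`. -/
abbrev VectorL2 (𝒪 : Set Plane) : Type := Lp Plane 2 (volume.restrict 𝒪)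

/-- `L²(𝒪; ℝ^{2×2})`. -/
abbrev MatrixL2 (𝒪 : Set Plane) : Type :=
  Lp (EuclideanSpace ℝ (Fin 2 × Fin 2)) 2 (volume.restrict 𝒪)

/-- `ℍ`: the closure of `𝒱` in `L²(𝒪; ℝ²)`, with the `L²` norm. (`𝒱` is a vector space, so the
span does not add anything.) -/
def hydroH (𝒪 : Set Plane) : Submodule ℝ (VectorL2 𝒪) :=
  (Submodule.span ℝ
    {u : VectorL2 𝒪 | ∃ φ ∈ divFreeTestFields 𝒪, u =ᵐ[volume.restrict 𝒪] φ}).topologicalClosure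

/-- `𝕍`: the completion of `𝒱` in the `H¹` norm `(‖u‖² + ‖∇u‖²)^{1/2}`, realised as the closure of
the pairs `(φ, ∇φ)`, `φ ∈ 𝒱`, in `L² × L²`. For `u` in `𝕍`, `u.1.fst` is the field and `u.1.snd` is
its gradient. On bounded `𝒪` the norm is equivalent to `‖∇u‖` by the Poincaré inequality. -/
def hydroV (𝒪 : Set Plane) : Submodule ℝ (WithLp 2 (VectorL2 𝒪 × MatrixL2 𝒪)) :=
  (Submodule.span ℝ
    {u : WithLp 2 (VectorL2 𝒪 × MatrixL2 𝒪) | ∃ φ ∈ divFreeTestFields 𝒪,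
      u.fst =ᵐ[volume.restrict 𝒪] φ ∧
      u.snd =ᵐ[volume.restrict 𝒪] planeGrad φ}).topologicalClosure

/-- The trilinear form `b(u, v, w) = ∑_{i,j} ∫_𝒪 u_i (∂_i v_j) w_j dx` on `𝕍`. -/
def trilinearForm {𝒪 : Set Plane} (u v w : hydroV 𝒪) : ℝ :=
  ∑ i, ∑ j, ∫ x in 𝒪, u.1.fst x i * v.1.snd x (i, j) * w.1.fst x j

/-! ### Weak solutions of the transformed system -/

/-- `v` is a weak solution on `[τ, ∞)`, for the path `ω`, of
`dv/dt + ν A v + e^{z(θ_t ω)} B(v) = e^{-z(θ_t ω)} f(t) + σ z(θ_t ω) v` in `𝕍'`, `v(τ) = v₀`: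
it lies in `C([τ, ∞); ℍ) ∩ L²_loc([τ, ∞); 𝕍)` and the equation, tested with any `w ∈ 𝕍` and
integrated in time, holds from `τ` to every `t ≥ τ`. Here `V` is `v` as a `𝕍`-valued function,
`⟨A u, w⟩ = ∫_𝒪 ∇u : ∇w` and `⟨B(u), w⟩ = b(u, u, w)`. -/
def IsWeakSolution {𝒪 : Set Plane} (ν σ : ℝ) (f : ℝ → hydroH 𝒪) (τ : ℝ) (ω : WienerPath)
    (v₀ : hydroH 𝒪) (v : ℝ → hydroH 𝒪) : Prop :=
  ContinuousOn v (Ici τ) ∧ v τ = v₀ ∧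
  ∃ V : ℝ → hydroV 𝒪,
    (∀ b : ℝ, MemLp V 2 (volume.restrict (Icc τ b))) ∧
    (∀ᵐ t ∂(volume.restrict (Ici τ)), (V t).1.fst = (v t : VectorL2 𝒪)) ∧
    ∀ w : hydroV 𝒪, ∀ t : ℝ, τ ≤ t →
      inner ℝ (v t : VectorL2 𝒪) w.1.fst = inner ℝ (v₀ : VectorL2 𝒪) w.1.fst +
        ∫ s in τ..t,
          (-(ν * inner ℝ (V s).1.snd w.1.snd)
            - Real.exp (ouVariable σ (wienerShift s ω)) * trilinearForm (V s) (V s) w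
            + Real.exp (-ouVariable σ (wienerShift s ω)) *
                inner ℝ (f s : VectorL2 𝒪) w.1.fst
            + σ * ouVariable σ (wienerShift s ω) * inner ℝ (v s : VectorL2 𝒪) w.1.fst)

end

/-! Translating time by `τ` removes the pullback: since `θ_{s+τ} θ_{-τ} ω = θ_s ω`, the function `s
↦ v(s+τ)` solves on `[0, T]` the same equation as the limit solution, with the same coefficients.
Only the initial value and the force `f(s+τ)` differ, and both differences vanish as `τ → -∞`. The
claim is thus continuous dependence on the data, with a constant independent of `τ`
(`exists_stability_const`).

For the difference `w = u₁ - u₂` the antisymmetry of `b` reduces the nonlinear term to `b(w, u₂,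
w)`. In the plane it is at most `C ‖w‖ ‖∇w‖ ‖∇u₂‖`, so the viscosity absorbs `‖∇w‖` and leaves a
coefficient `‖∇u₂‖²`, which is integrable in time. Grönwall then gives a constant that depends on
`u₂` and the path only, and `u₂` is the fixed limit solution.

Three inputs need work. The energy identity for `w` is not immediate, because `w` itself is not an
admissible test function; `norm_sq_eq_of_weak_derivative` obtains it from difference quotients in
time. The bound on the convective term is Ladyzhenskaya's inequality, proved for test fields and
extended to `𝕍` by density. Finally, `z(θ_t ω)` must be continuous in `t`, which follows from an
explicit formula on `ouPaths σ`; that set has full measure by a first-moment bound. -/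

noncomputable section

/-! ### Wiener paths and continuity of the Ornstein-Uhlenbeck process -/

lemma lintegral_enorm_gaussianReal_le (v : ℝ≥0) :
    ∫⁻ x, ‖x‖ₑ ∂(gaussianReal 0 v) ≤ 1 + v := by
  have h2 : ∫⁻ x, ‖x‖ₑ ^ 2 ∂(gaussianReal 0 v) = v := by
    have h := ProbabilityTheory.variance_id_gaussianReal (μ := 0) (v := v)
    have hm : MemLp (id : ℝ → ℝ) 2 (gaussianReal 0 v) :=
      ProbabilityTheory.memLp_id_gaussianReal 2
    have := hm.ofReal_variance_eq
    rw [h, ProbabilityTheory.evariance] at this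
    simpa [ProbabilityTheory.integral_id_gaussianReal] using this.symm
  calc ∫⁻ x, ‖x‖ₑ ∂(gaussianReal 0 v) ≤ ∫⁻ x, (1 + ‖x‖ₑ ^ 2) ∂(gaussianReal 0 v) := by
        refine lintegral_mono fun x => ?_
        rcases le_total ‖x‖ₑ 1 with h | h
        · exact h.trans le_self_add
        · calc ‖x‖ₑ = ‖x‖ₑ * 1 := (mul_one _).symm
            _ ≤ ‖x‖ₑ ^ 2 := by rw [sq]; gcongr
            _ ≤ _ := le_add_self
    _ = 1 + v := by
        rw [lintegral_add_left (by fun_prop), h2]; simp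

/-- Half of the exponential decay absorbs the linear factor, by `x + 1 ≤ exp x` at `x = -σ s / 2`.
-/
lemma integrableOn_exp_mul_one_add_abs {σ : ℝ} (hσ : 0 < σ) :
    IntegrableOn (fun s : ℝ => Real.exp (σ * s) * (1 + |s|)) (Iic 0) := by
  have h := (integrableOn_exp_mul_Iic (half_pos hσ) 0).const_mul (1 + 2 / σ)
  refine Integrable.mono' h (by fun_prop) ?_
  filter_upwards [ae_restrict_mem measurableSet_Iic] with s hs
  have hs : s ≤ 0 := hs
  rw [Real.norm_of_nonneg (by positivity), abs_of_nonpos hs]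
  have h1 : 1 + -s ≤ (1 + 2 / σ) * Real.exp (-(σ / 2 * s)) := by
    have h2 := Real.add_one_le_exp (-(σ / 2 * s))
    have h3 : -s = 2 / σ * (-(σ / 2 * s)) := by field_simp
    have h4 : 1 ≤ Real.exp (-(σ / 2 * s)) := Real.one_le_exp (by nlinarith)
    have h5 : 0 < 2 / σ := by positivity
    nlinarith
  calc Real.exp (σ * s) * (1 + -s)
      ≤ Real.exp (σ * s) * ((1 + 2 / σ) * Real.exp (-(σ / 2 * s))) := by gcongr
    _ = (1 + 2 / σ) * Real.exp (σ / 2 * s) := by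
        rw [mul_left_comm, ← Real.exp_add]; ring_nf

/-- A Carathéodory function (continuous in time, measurable in the path) is jointly measurable;
Tonelli needs this below. -/
lemma measurable_wienerPath_eval : Measurable fun p : WienerPath × ℝ => p.1.1 p.2 := by
  have h : Continuous fun p : ℝ × WienerPath => p.2.1 p.1 := by fun_prop
  have := measurable_uncurry_of_continuous_of_measurable (ι := ℝ) (α := WienerPath)
    (u := fun t ω => ω.1 t) (fun ω => ω.1.continuous)
    (fun t => (show Continuous fun ω : WienerPath => ω.1 t by fun_prop).measurable)
  exact this.comp measurable_swap

/-- By Tonelli the expectation of the weighted path integral is at most `∫ e^{σ s} (1 + |s|) ds <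
∞`, because `E|ω(s)| ≤ 1 + E ω(s)² = 1 + |s|`. A variable of finite expectation is finite almost
surely. -/
theorem ae_mem_ouPaths {σ : ℝ} (hσ : 0 < σ) {P : Measure WienerPath}
    (hP : IsTwoSidedWienerMeasure P) : ∀ᵐ ω ∂P, ω ∈ ouPaths σ := by
  have := hP.isProbabilityMeasure
  have hmeas : Measurable fun p : WienerPath × ℝ => Real.exp (σ * p.2) * p.1.1 p.2 :=
    (by fun_prop : Measurable fun p : WienerPath × ℝ => Real.exp (σ * p.2)).mul
      measurable_wienerPath_eval
  have hE : ∀ s : ℝ, ∫⁻ ω : WienerPath, ‖ω.1 s‖ₑ ∂P ≤ ENNReal.ofReal (1 + |s|) := by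
    intro s
    have hl := hP.hasLaw_increment 0 s
    have h1 : ∫⁻ ω : WienerPath, ‖ω.1 s‖ₑ ∂P =
        ∫⁻ x, ‖x‖ₑ ∂(gaussianReal 0 (nndist 0 s)) := by
      rw [← hl.map_eq, lintegral_map' (by fun_prop) hl.aemeasurable]
      refine lintegral_congr fun ω => ?_
      rw [ω.2, sub_zero]
    rw [h1]
    refine (lintegral_enorm_gaussianReal_le _).trans (le_of_eq ?_)
    rw [ENNReal.ofReal_add zero_le_one (abs_nonneg _), ENNReal.ofReal_one]
    congr 1
    rw [← Real.norm_eq_abs, ofReal_norm, ← edist_nndist, edist_comm, edist_zero_right]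
  have hfin : ∫⁻ ω : WienerPath, (∫⁻ s in Iic (0 : ℝ), ‖Real.exp (σ * s) * ω.1 s‖ₑ) ∂P ≠ ∞ := by
    rw [lintegral_lintegral_swap hmeas.enorm.aemeasurable]
    refine ne_of_lt (lt_of_le_of_lt ?_ (integrableOn_exp_mul_one_add_abs hσ).2)
    refine lintegral_mono fun s => ?_
    simp_rw [enorm_mul]
    rw [lintegral_const_mul' _ _ (by simp)]
    gcongr
    refine (hE s).trans (le_of_eq ?_)
    rw [← ofReal_norm, Real.norm_of_nonneg (by positivity)]
  have hm2 : AEMeasurable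
      (fun ω : WienerPath => ∫⁻ s in Iic (0 : ℝ), ‖Real.exp (σ * s) * ω.1 s‖ₑ) P :=
    (Measurable.lintegral_prod_right' hmeas.enorm).aemeasurable
  filter_upwards [ae_lt_top' hm2 hfin] with ω hω
  exact ⟨by fun_prop, hω⟩

lemma integrableOn_exp_mul_Iic_of_mem {σ : ℝ} {ω : WienerPath} (hω : ω ∈ ouPaths σ) (t : ℝ) :
    IntegrableOn (fun s : ℝ => Real.exp (σ * s) * ω.1 s) (Iic t) := by
  have hc : Continuous fun s : ℝ => Real.exp (σ * s) * ω.1 s := by fun_prop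
  refine (IntegrableOn.union hω (hc.integrableOn_Icc (a := 0) (b := t))).mono_set ?_
  intro s hs
  rcases le_total s 0 with h | h
  · exact Or.inl h
  · exact Or.inr ⟨h, hs⟩

lemma exp_mul_wienerShift (σ t s : ℝ) (ω : WienerPath) :
    Real.exp (σ * s) * (wienerShift t ω).1 s =
      Real.exp (-(σ * t)) * (Real.exp (σ * (s + t)) * ω.1 (s + t))
        - ω.1 t * Real.exp (σ * s) := by
  change Real.exp (σ * s) * (ω.1 (s + t) - ω.1 t) = _
  rw [← mul_assoc, ← Real.exp_add]
  ring_nf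

lemma integrableOn_comp_add_Iic {σ : ℝ} {ω : WienerPath} (hω : ω ∈ ouPaths σ) (t : ℝ) :
    IntegrableOn (fun s : ℝ => Real.exp (σ * (s + t)) * ω.1 (s + t)) (Iic 0) := by
  have := integrableOn_exp_mul_Iic_of_mem hω t
  have h := (measurePreserving_add_right (volume : Measure ℝ) t).integrableOn_comp_preimage
    (measurableEmbedding_addRight t) (f := fun s : ℝ => Real.exp (σ * s) * ω.1 s) (s := Iic t)
  rw [Set.preimage_add_const_Iic, sub_self] at h
  exact h.2 this

theorem wienerShift_mem_ouPaths {σ : ℝ} (hσ : 0 < σ) (t : ℝ) {ω : WienerPath}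
    (hω : ω ∈ ouPaths σ) : wienerShift t ω ∈ ouPaths σ := by
  change IntegrableOn (fun s => Real.exp (σ * s) * (wienerShift t ω).1 s) (Iic 0)
  simp_rw [exp_mul_wienerShift]
  exact ((integrableOn_comp_add_Iic hω t).const_mul _).sub
    ((integrableOn_exp_mul_Iic hσ 0).const_mul _)

/-- Substituting `s + t` moves all dependence on `t` into elementary factors and a primitive, which
makes continuity in `t` visible. -/
lemma ouVariable_wienerShift {σ : ℝ} (hσ : 0 < σ) (t : ℝ) {ω : WienerPath}
    (hω : ω ∈ ouPaths σ) :
    ouVariable σ (wienerShift t ω) =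
      -σ * (Real.exp (-(σ * t)) * ((∫ s in Iic (0 : ℝ), Real.exp (σ * s) * ω.1 s)
        + ∫ s in (0 : ℝ)..t, Real.exp (σ * s) * ω.1 s) - ω.1 t * (1 / σ)) := by
  rw [ouVariable]
  simp_rw [exp_mul_wienerShift]
  rw [integral_sub ((integrableOn_comp_add_Iic hω t).const_mul _)
    ((integrableOn_exp_mul_Iic hσ 0).const_mul _), integral_const_mul, integral_const_mul,
    integral_exp_mul_Iic hσ]
  have h1 : ∫ s in Iic (0 : ℝ), Real.exp (σ * (s + t)) * ω.1 (s + t) =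
      ∫ s in Iic t, Real.exp (σ * s) * ω.1 s := by
    have h := (measurePreserving_add_right (volume : Measure ℝ) t).setIntegral_preimage_emb
      (measurableEmbedding_addRight t) (fun s : ℝ => Real.exp (σ * s) * ω.1 s) (Iic t)
    rwa [Set.preimage_add_const_Iic, sub_self] at h
  rw [h1, ← intervalIntegral.integral_Iic_sub_Iic hω (integrableOn_exp_mul_Iic_of_mem hω t)]
  simp

theorem continuous_ouVariable_wienerShift {σ : ℝ} (hσ : 0 < σ) {ω : WienerPath}
    (hω : ω ∈ ouPaths σ) : Continuous fun t => ouVariable σ (wienerShift t ω) := by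
  simp_rw [ouVariable_wienerShift hσ _ hω]
  have hc : Continuous fun s : ℝ => Real.exp (σ * s) * ω.1 s := by fun_prop
  have h2 : Continuous fun t => ∫ s in (0 : ℝ)..t, Real.exp (σ * s) * ω.1 s :=
    intervalIntegral.continuous_primitive (fun a b => hc.intervalIntegrable a b) 0
  fun_prop

lemma wienerShift_wienerShift (s t : ℝ) (ω : WienerPath) :
    wienerShift s (wienerShift t ω) = wienerShift (s + t) ω := by
  apply Subtype.ext
  ext r
  simp [wienerShift, add_assoc]

/-! ### Translations in time and the energy identity -/

/-- This is strong continuity of the translation action on `Lp`, written for a representative. -/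
lemma tendsto_eLpNorm_translate_sub {E : Type*} [NormedAddCommGroup E] {f : ℝ → E}
    (hf : MemLp f 2 volume) :
    Tendsto (fun h => eLpNorm (fun x => f (x + h) - f x) 2 volume) (𝓝 0) (𝓝 0) := by
  have : Fact ((2 : ℝ≥0∞) ≠ ∞) := ⟨by simp⟩
  let F : Lp E 2 (volume : Measure ℝ) := hf.toLp f
  have hc : Continuous fun h : ℝ => DomAddAct.mk h +ᵥ F :=
    (DomAddAct.continuous_mk).vadd continuous_const
  have h1 : Tendsto (fun h : ℝ => edist (DomAddAct.mk h +ᵥ F) F) (𝓝 0) (𝓝 0) := by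
    have := (hc.edist continuous_const (g := fun _ => F)).tendsto 0
    simpa using this
  refine h1.congr fun h => ?_
  rw [DomAddAct.mk_vadd_toLp, Lp.edist_toLp_toLp]
  refine congrArg (fun g => eLpNorm g 2 volume) (funext fun x => ?_)
  simp [add_comm]

lemma aestronglyMeasurable_comp_add_prod {E : Type*} [NormedAddCommGroup E] {f : ℝ → E}
    (hf : AEStronglyMeasurable f volume) :
    AEStronglyMeasurable (fun p : ℝ × ℝ => f (p.1 + p.2))
      ((volume : Measure ℝ).prod volume) :=
  hf.comp_quasiMeasurePreserving
    (Measure.quasiMeasurePreserving_snd.comp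
      (measurePreserving_prod_add (volume : Measure ℝ) volume).quasiMeasurePreserving)

lemma lintegral_enorm_mul_le_eLpNorm_mul {α E F : Type*} [MeasurableSpace α] {μ : Measure α}
    [NormedAddCommGroup E] [NormedAddCommGroup F] {f : α → E} {g : α → F}
    (hf : AEStronglyMeasurable f μ) (hg : AEStronglyMeasurable g μ) :
    ∫⁻ x, ‖f x‖ₑ * ‖g x‖ₑ ∂μ ≤ eLpNorm f 2 μ * eLpNorm g 2 μ := by
  have := ENNReal.lintegral_mul_le_Lp_mul_Lq μ Real.HolderConjugate.two_two
    hf.enorm hg.enorm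
  simpa [eLpNorm_eq_lintegral_rpow_enorm_toReal (p := 2) (by simp) (by simp)] using this

lemma MeasureTheory.MemLp.indicator_of_restrict {α E : Type*} [MeasurableSpace α] {μ : Measure α}
    [NormedAddCommGroup E] {s : Set α} (hs : MeasurableSet s) {p : ℝ≥0∞} {f : α → E}
    (hf : MemLp f p (μ.restrict s)) : MemLp (s.indicator f) p μ :=
  (memLp_indicator_iff_restrict hs).2 hf

section Energy

variable {V H : Type*} [NormedAddCommGroup V] [InnerProductSpace ℝ V]
  [NormedAddCommGroup H] [InnerProductSpace ℝ H]

/-- This controls the error made on replacing `∫₀ʰ G(s+r)(W(s+h) + W(s)) dr` by `2h G(s) W(s)`.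
After swapping the integrals, Cauchy-Schwarz in `s` gives a factor `η` for each `r`, and `r` ranges
over an interval of length `h`. -/
lemma lintegral_translate_pairing_le {E F : Type*} [NormedAddCommGroup E]
    [NormedAddCommGroup F] {G : ℝ → E} {W : ℝ → F}
    (hG : MemLp G 2 volume) (hW : MemLp W 2 volume) {η : ℝ≥0∞} {h : ℝ}
    (hGη : ∀ r ∈ Ioc 0 h, eLpNorm (fun x => G (x + r) - G x) 2 volume ≤ η)
    (hWη : eLpNorm (fun x => W (x + h) - W x) 2 volume ≤ η) :
    ∫⁻ s : ℝ, ∫⁻ r in Ioc 0 h, (‖G (s + r) - G s‖ₑ * (‖W (s + h)‖ₑ + ‖W s‖ₑ)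
        + ‖G s‖ₑ * ‖W (s + h) - W s‖ₑ) ≤
      ENNReal.ofReal h * (η * (2 * eLpNorm W 2 volume + eLpNorm G 2 volume)) := by
  have mp : ∀ r : ℝ, MeasurePreserving (fun x : ℝ => x + r) volume volume :=
    measurePreserving_add_right volume
  have hWh : MemLp (fun x => W (x + h)) 2 volume := hW.comp_measurePreserving (mp h)
  have hWhn : eLpNorm (fun x => W (x + h)) 2 volume = eLpNorm W 2 volume :=
    eLpNorm_comp_measurePreserving hW.1 (mp h)
  have hGr : ∀ r, AEStronglyMeasurable (fun x => G (x + r)) volume := fun r =>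
    hG.1.comp_measurePreserving (mp r)
  have hGm : AEStronglyMeasurable (fun p : ℝ × ℝ => G (p.1 + p.2) - G p.1)
      ((volume : Measure ℝ).prod (volume.restrict (Ioc 0 h))) :=
    ((aestronglyMeasurable_comp_add_prod hG.1).mono_ac
      (Measure.AbsolutelyContinuous.rfl.prod Measure.restrict_le_self.absolutelyContinuous)).sub
      hG.1.comp_fst
  rw [lintegral_lintegral_swap]
  · calc _ ≤ ∫⁻ r in Ioc 0 h, (η * (2 * eLpNorm W 2 volume + eLpNorm G 2 volume)) := by
          refine setLIntegral_mono' measurableSet_Ioc fun r hr => ?_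
          have m1 : AEStronglyMeasurable (fun x => G (x + r) - G x) volume := (hGr r).sub hG.1
          have m2 : AEStronglyMeasurable (fun x => W (x + h) - W x) volume := hWh.1.sub hW.1
          have m3 : AEMeasurable (fun x => ‖G x‖ₑ * ‖W (x + h) - W x‖ₑ) volume :=
            hG.1.enorm.mul m2.enorm
          have m4 : AEMeasurable (fun x => ‖G (x + r) - G x‖ₑ * ‖W x‖ₑ) volume :=
            m1.enorm.mul hW.1.enorm
          rw [lintegral_add_right' _ m3]
          simp_rw [mul_add]
          rw [lintegral_add_right' _ m4]
          have e1 := lintegral_enorm_mul_le_eLpNorm_mul m1 hWh.1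
          have e2 := lintegral_enorm_mul_le_eLpNorm_mul m1 hW.1
          have e3 := lintegral_enorm_mul_le_eLpNorm_mul hG.1 m2
          rw [hWhn] at e1
          have k1 := hGη r hr
          calc _ ≤ η * eLpNorm W 2 volume + η * eLpNorm W 2 volume
                + eLpNorm G 2 volume * η := by
                gcongr
                · exact e1.trans (mul_le_mul_left k1 _)
                · exact e2.trans (mul_le_mul_left k1 _)
                · exact e3.trans (mul_le_mul_right hWη _)
            _ = _ := by ring
    _ = _ := by
          rw [lintegral_const, Measure.restrict_apply_univ, Real.volume_Ioc, sub_zero, mul_comm]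
  · refine AEMeasurable.add (hGm.enorm.mul ?_) ?_
    · exact (hWh.1.enorm.add hW.1.enorm).comp_fst
    · exact (hG.1.enorm.mul (hWh.1.sub hW.1).enorm).comp_fst

/-- The energy identity for functions `w` in `C(H) ∩ L²(V)` whose weak derivative lies in
`L²(V')`. -/
theorem norm_sq_eq_of_weak_derivative (ι : V →L[ℝ] H) {T : ℝ} (hT : 0 ≤ T) {w : ℝ → H}
    (hw : Continuous w) {W : ℝ → V} (hW : MemLp W 2 (volume.restrict (Icc 0 T)))
    (hwW : ∀ᵐ t ∂(volume.restrict (Icc 0 T)), ι (W t) = w t)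
    {G : ℝ → V →L[ℝ] ℝ} (hG : MemLp G 2 (volume.restrict (Icc 0 T)))
    (heq : ∀ φ : V, ∀ t ∈ Icc 0 T,
      inner ℝ (w t) (ι φ) = inner ℝ (w 0) (ι φ) + ∫ s in (0 : ℝ)..t, G s φ) :
    ‖w T‖ ^ 2 = ‖w 0‖ ^ 2 + 2 * ∫ s in (0 : ℝ)..T, G s (W s) := by
  rcases hT.eq_or_lt with rfl | hT0
  · simp
  -- Extension by zero makes translations act on `L²` of the whole line.
  set G' : ℝ → V →L[ℝ] ℝ := (Icc 0 T).indicator G with hG'def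
  set W' : ℝ → V := (Icc 0 T).indicator W with hW'def
  have hG' : MemLp G' 2 volume := hG.indicator_of_restrict measurableSet_Icc
  have hW' : MemLp W' 2 volume := hW.indicator_of_restrict measurableSet_Icc
  have hGW : Integrable (fun s => G' s (W' s)) volume := by
    have h1 : Integrable (fun s => ‖G' s‖ * ‖W' s‖) volume :=
      MemLp.integrable_mul hG'.norm hW'.norm
    refine h1.mono' ?_ (Eventually.of_forall fun s => (G' s).le_opNorm _)
    exact isBoundedBilinearMap_apply.continuous.comp_aestronglyMeasurable₂ hG'.1 hW'.1
  have hGi : Integrable G' volume := memLp_one_iff_integrable.1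
    ((hG.mono_exponent (by norm_num)).indicator_of_restrict measurableSet_Icc)
  have hGφ : ∀ φ : V, Integrable (fun s => G' s φ) volume := fun φ =>
    hGi.apply_continuousLinearMap φ
  have hincr : ∀ φ : V, ∀ s h : ℝ, 0 ≤ s → 0 ≤ h → s + h ≤ T →
      inner ℝ (w (s + h) - w s) (ι φ) = ∫ r in (0 : ℝ)..h, G' (s + r) φ := by
    intro φ s h hs hh hsh
    have key : ∀ t ∈ Icc 0 T,
        inner ℝ (w t) (ι φ) = inner ℝ (w 0) (ι φ) + ∫ s in (0 : ℝ)..t, G' s φ := by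
      intro t ht
      rw [heq φ t ht]
      congr 1
      refine intervalIntegral.integral_congr fun r hr => ?_
      rw [uIcc_of_le ht.1] at hr
      simp only [hG'def]
      rw [indicator_of_mem (show r ∈ Icc 0 T from ⟨hr.1, hr.2.trans ht.2⟩)]
    rw [inner_sub_left, key (s + h) ⟨by linarith, hsh⟩, key s ⟨hs, by linarith⟩,
      add_sub_add_left_eq_sub, intervalIntegral.integral_interval_sub_left
        (hGφ φ).intervalIntegrable (hGφ φ).intervalIntegrable,
      intervalIntegral.integral_comp_add_left (fun r => G' r φ) s, add_zero]
  have hae : ∀ᵐ t : ℝ, t ∈ Icc 0 T → ι (W' t) = w t := by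
    rw [ae_restrict_iff' measurableSet_Icc] at hwW
    filter_upwards [hwW] with t ht h
    rw [hW'def, indicator_of_mem h, ht h]
  set N : ℝ → ℝ := fun t => ‖w t‖ ^ 2 with hNdef
  have hNc : Continuous N := by fun_prop
  -- The key identity is `‖w(s+h)‖² - ‖w(s)‖² = ⟪w(s+h) - w(s), w(s+h) + w(s)⟫`: for fixed `s` and
  -- `h` the second factor is an admissible test vector, so the equation applies to it.
  have hbound : ∀ h : ℝ, 0 < h → h < T → ∀ η : ℝ≥0∞,
      (∀ r ∈ Ioc 0 h, eLpNorm (fun x => G' (x + r) - G' x) 2 volume ≤ η) →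
      eLpNorm (fun x => W' (x + h) - W' x) 2 volume ≤ η →
      ‖∫ s in (0 : ℝ)..(T - h), (N (s + h) - N s - h * (2 * G' s (W' s)))‖ₑ ≤
        ENNReal.ofReal h * (η * (2 * eLpNorm W' 2 volume + eLpNorm G' 2 volume)) := by
    intro h h0 hhT η h1 h2
    refine le_trans ?_ (lintegral_translate_pairing_le hG' hW' h1 h2)
    rw [intervalIntegral.integral_of_le (by linarith)]
    refine (enorm_integral_le_lintegral_enorm _).trans
      (le_trans (lintegral_mono_ae ?_) (setLIntegral_le_lintegral (Ioc 0 (T - h)) _))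
    refine (ae_restrict_iff' measurableSet_Ioc).2 ?_
    filter_upwards [hae, (measurePreserving_add_right volume h).quasiMeasurePreserving.ae hae]
      with s hs1 hs2 hs
    have e1 := hs1 ⟨hs.1.le, by linarith [hs.2]⟩
    have e2 := hs2 ⟨by linarith [hs.1], by linarith [hs.2]⟩
    have hint : IntervalIntegrable (fun r => G' (s + r) (W' (s + h) + W' s)) volume 0 h :=
      ((hGφ _).comp_add_left s).intervalIntegrable
    have e3 : N (s + h) - N s - h * (2 * G' s (W' s)) =
        ∫ r in (0 : ℝ)..h,
          (G' (s + r) (W' (s + h) + W' s) - 2 * G' s (W' s)) := by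
      rw [intervalIntegral.integral_sub hint (by simp), intervalIntegral.integral_const,
        ← hincr _ s h hs.1.le h0.le (by linarith [hs.2]), map_add, e1, e2]
      simp only [hNdef, inner_sub_left, inner_add_right, real_inner_self_eq_norm_sq,
        real_inner_comm (w s) (w (s + h)), sub_zero, smul_eq_mul]
      ring
    rw [e3, intervalIntegral.integral_of_le h0.le]
    refine (enorm_integral_le_lintegral_enorm _).trans (lintegral_mono fun r => ?_)
    have e4 : G' (s + r) (W' (s + h) + W' s) - 2 * G' s (W' s) =
        (G' (s + r) - G' s) (W' (s + h) + W' s) + G' s (W' (s + h) - W' s) := by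
      simp only [sub_apply, map_add, map_sub]
      ring
    rw [e4]
    refine (enorm_add_le _ _).trans (add_le_add ?_ ?_)
    · refine (ContinuousLinearMap.le_opENorm _ _).trans ?_
      gcongr
      exact enorm_add_le _ _
    · exact ContinuousLinearMap.le_opENorm _ _
  set Φ : ℝ → ℝ := fun t => ∫ s in (0 : ℝ)..t, N s with hΦ
  set Ξ : ℝ → ℝ := fun t => ∫ s in (0 : ℝ)..t, 2 * G' s (W' s) with hΞ
  have hΞc : Continuous Ξ := intervalIntegral.continuous_primitive
    (fun a b => (hGW.const_mul 2).intervalIntegrable) 0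
  have hΦd : ∀ t, HasDerivAt Φ (N t) t := fun t =>
    (hNc.integral_hasStrictDerivAt 0 t).hasDerivAt
  -- The integrated difference telescopes into primitives of `N`; divided by `h`, their combination
  -- tends to `N T - N 0`.
  have hsplit : ∀ h : ℝ,
      ∫ s in (0 : ℝ)..(T - h), (N (s + h) - N s - h * (2 * G' s (W' s))) =
        (Φ T - Φ h - Φ (T - h)) - h * Ξ (T - h) := by
    intro h
    have i1 : IntervalIntegrable (fun s => N (s + h)) volume 0 (T - h) :=
      (hNc.comp (continuous_add_const h)).intervalIntegrable _ _
    have i2 := hNc.intervalIntegrable (μ := volume) 0 (T - h)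
    rw [intervalIntegral.integral_sub (i1.sub i2)
      ((hGW.const_mul 2).const_mul h).intervalIntegrable,
      intervalIntegral.integral_sub i1 i2, intervalIntegral.integral_const_mul,
      intervalIntegral.integral_comp_add_right, zero_add, sub_add_cancel,
      ← intervalIntegral.integral_interval_sub_left (hNc.intervalIntegrable 0 T)
        (hNc.intervalIntegrable 0 h)]
  have hderiv : Tendsto (fun h : ℝ => h⁻¹ * (Φ T - Φ h - Φ (T - h))) (𝓝[>] 0)
      (𝓝 (N T - N 0)) := by
    have hd : HasDerivAt (fun h => Φ T - Φ h - Φ (T - h)) (N T - N 0) 0 := by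
      have h1 : HasDerivAt (fun h => Φ (T - h)) (-N T) 0 := by
        have h2 : HasDerivAt Φ (N T) (T - 0) := by simpa using hΦd T
        exact h2.comp_const_sub T 0
      exact (((hΦd 0).const_sub (Φ T)).sub h1).congr_deriv (by ring)
    have := hd.tendsto_slope_zero_right
    refine this.congr fun h => ?_
    have : Φ 0 = 0 := by simp [hΦ]
    simp [this]
  have hmain : ∀ ε : ℝ, 0 < ε → |N T - N 0 - Ξ T| ≤ ε := by
    intro ε hε
    set C : ℝ≥0∞ := 2 * eLpNorm W' 2 volume + eLpNorm G' 2 volume with hC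
    have hCfin : C ≠ ∞ := by
      simp [hC, hW'.2.ne, hG'.2.ne, ENNReal.mul_eq_top]
    -- The `+ 1` covers the case `C = 0`.
    set η : ℝ≥0∞ := ENNReal.ofReal (ε / (C.toReal + 1)) with hη
    have hη0 : 0 < η := ENNReal.ofReal_pos.2 (by positivity)
    have hηC : η * C ≤ ENNReal.ofReal ε := by
      rw [← ENNReal.ofReal_toReal hCfin, hη, ← ENNReal.ofReal_mul (by positivity)]
      refine ENNReal.ofReal_le_ofReal ?_
      rw [div_mul_eq_mul_div, div_le_iff₀ (by positivity)]
      nlinarith [ENNReal.toReal_nonneg (a := C)]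
    have t1 := (tendsto_eLpNorm_translate_sub hG').eventually (gt_mem_nhds hη0)
    have t2 := (tendsto_eLpNorm_translate_sub hW').eventually (gt_mem_nhds hη0)
    obtain ⟨δ, hδ, hδ'⟩ := Metric.eventually_nhds_iff.1 (t1.and t2)
    have hev : ∀ᶠ h in 𝓝[>] (0 : ℝ),
        |h⁻¹ * (Φ T - Φ h - Φ (T - h)) - Ξ (T - h)| ≤ ε := by
      filter_upwards [Ioo_mem_nhdsGT (lt_min hδ hT0)] with h hh
      have hhδ : h < δ := hh.2.trans_le (min_le_left _ _)
      have hhT : h < T := hh.2.trans_le (min_le_right _ _)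
      have b := hbound h hh.1 hhT η
        (fun r hr => (hδ' (y := r) (by
          rw [Real.dist_eq, sub_zero, abs_of_pos hr.1]; linarith [hr.2])).1.le)
        (hδ' (y := h) (by rw [Real.dist_eq, sub_zero, abs_of_pos hh.1]; exact hhδ)).2.le
      rw [hsplit] at b
      have b2 := b.trans (mul_le_mul_right hηC _)
      rw [← ENNReal.ofReal_mul hh.1.le, ← ofReal_norm,
        ENNReal.ofReal_le_ofReal_iff (by have := hh.1; positivity), Real.norm_eq_abs] at b2
      have e : h⁻¹ * (Φ T - Φ h - Φ (T - h)) - Ξ (T - h) =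
          h⁻¹ * (Φ T - Φ h - Φ (T - h) - h * Ξ (T - h)) := by
        have := hh.1.ne'
        field_simp
      rw [e, abs_mul, abs_of_pos (inv_pos.2 hh.1), inv_mul_le_iff₀ hh.1]
      exact b2
    have hlim : Tendsto (fun h => |h⁻¹ * (Φ T - Φ h - Φ (T - h)) - Ξ (T - h)|) (𝓝[>] 0)
        (𝓝 |N T - N 0 - Ξ T|) := by
      have c : Tendsto (fun h => Ξ (T - h)) (𝓝[>] 0) (𝓝 (Ξ T)) := by
        have : Continuous fun h => Ξ (T - h) := by fun_prop
        simpa using (this.tendsto 0).mono_left nhdsWithin_le_nhds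
      exact (hderiv.sub c).abs
    exact le_of_tendsto hlim hev
  have h0 : N T - N 0 - Ξ T = 0 :=
    abs_nonpos_iff.1 (le_of_forall_pos_le_add fun ε hε => by simpa using hmain ε hε)
  have hΞT : Ξ T = 2 * ∫ s in (0 : ℝ)..T, G s (W s) := by
    rw [hΞ, ← intervalIntegral.integral_const_mul]
    refine intervalIntegral.integral_congr fun r hr => ?_
    rw [uIcc_of_le hT] at hr
    simp only [hG'def, hW'def]
    rw [indicator_of_mem hr, indicator_of_mem hr]
  have : N T = N 0 + Ξ T := by linarith
  rw [← hΞT]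
  exact this

end Energy

/-! ### Grönwall's inequality and square-integrability in time -/

/-- Grönwall's inequality in integral form with an integrable coefficient. The constant depends
only on the coefficient. -/
theorem exists_gronwall_const {T : ℝ} (hT : 0 ≤ T) {a : ℝ → ℝ} (ha0 : ∀ s, 0 ≤ a s)
    (ha : IntegrableOn a (Icc 0 T)) :
    ∃ K : ℝ, ∀ (d : ℝ) (φ : ℝ → ℝ), Continuous φ → (∀ s, 0 ≤ φ s) →
      (∀ t ∈ Icc 0 T, φ t ≤ d + ∫ s in (0 : ℝ)..t, a s * φ s) → φ T ≤ K * d := by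
  have hai : ∀ s ∈ Icc 0 T, ∀ t ∈ Icc 0 T, IntervalIntegrable a volume s t := fun s hs t ht =>
    (ha.mono_set (uIcc_subset_Icc hs ht)).intervalIntegrable
  have hc : ContinuousOn (fun t => ∫ s in (0 : ℝ)..t, a s) (Icc 0 T) := by
    have := intervalIntegral.continuousOn_primitive_interval (f := a) (a := 0) (b := T)
      (μ := volume) (by rwa [uIcc_of_le hT])
    rwa [uIcc_of_le hT] at this
  -- On windows of length `δ/2 < δ` the coefficient has integral at most `1/2`. Hence `Ψ t ≤ Ψ s + Ψ
  -- t / 2`, so `Ψ` at most doubles per window, and `n` windows cover `[0, T]`.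
  obtain ⟨δ, hδ, hδ'⟩ := Metric.uniformContinuousOn_iff.1
    (isCompact_Icc.uniformContinuousOn_of_continuous hc) (1 / 2) (by norm_num)
  obtain ⟨n, hn⟩ := exists_nat_gt (T / (δ / 2))
  refine ⟨2 ^ n, fun d φ hφ hφ0 hle => ?_⟩
  have hi : ∀ s ∈ Icc 0 T, ∀ t ∈ Icc 0 T, IntervalIntegrable (fun r => a r * φ r) volume s t :=
    fun s hs t ht => (hai s hs t ht).mul_continuousOn hφ.continuousOn
  set Ψ : ℝ → ℝ := fun t => d + ∫ s in (0 : ℝ)..t, a s * φ s with hΨ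
  have h0 : (0 : ℝ) ∈ Icc 0 T := ⟨le_rfl, hT⟩
  have hsub : ∀ s ∈ Icc 0 T, ∀ t ∈ Icc 0 T, Ψ t - Ψ s = ∫ r in s..t, a r * φ r := by
    intro s hs t ht
    simp only [hΨ]
    rw [add_sub_add_left_eq_sub,
      intervalIntegral.integral_interval_sub_left (hi 0 h0 t ht) (hi 0 h0 s hs)]
  have hmono : ∀ s ∈ Icc 0 T, ∀ t ∈ Icc 0 T, s ≤ t → Ψ s ≤ Ψ t := by
    intro s hs t ht hst
    have := intervalIntegral.integral_nonneg (μ := volume) hst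
      (fun r _ => mul_nonneg (ha0 r) (hφ0 r))
    linarith [hsub s hs t ht]
  have hstep : ∀ k : ℕ, ∀ t ∈ Icc 0 T, t ≤ k * (δ / 2) → Ψ t ≤ 2 ^ k * d := by
    intro k
    induction k with
    | zero =>
      intro t ht htk
      have : t = 0 := le_antisymm (by simpa using htk) ht.1
      simp [hΨ, this]
    | succ k ih =>
      intro t ht htk
      push_cast at htk
      set s := max (t - δ / 2) 0 with hs
      have hst : s ≤ t := max_le (by linarith) ht.1
      have hsT : s ∈ Icc 0 T := ⟨le_max_right _ _, hst.trans ht.2⟩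
      have h1 := ih s hsT (max_le (by linarith) (by positivity))
      have hA : ∫ r in s..t, a r ≤ 1 / 2 := by
        have h2 := hδ' t ht s hsT (by
          rw [Real.dist_eq, abs_of_nonneg (by linarith)]
          have := le_max_left (t - δ / 2) 0
          linarith)
        rw [Real.dist_eq, intervalIntegral.integral_interval_sub_left (hai 0 h0 t ht)
          (hai 0 h0 s hsT)] at h2
        exact (le_abs_self _).trans h2.le
      have h3 : ∫ r in s..t, a r * φ r ≤ ∫ r in s..t, a r * Ψ t := by
        refine intervalIntegral.integral_mono_on hst (hi s hsT t ht)
          ((hai s hsT t ht).mul_const _) fun r hr => ?_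
        have hrT : r ∈ Icc 0 T := ⟨hsT.1.trans hr.1, hr.2.trans ht.2⟩
        exact mul_le_mul_of_nonneg_left
          ((hle r hrT).trans (hmono r hrT t ht hr.2)) (ha0 r)
      rw [intervalIntegral.integral_mul_const] at h3
      have hΨ0 : 0 ≤ Ψ t := (hφ0 t).trans (hle t ht)
      have h4 := hsub s hsT t ht
      have h5 := mul_le_mul_of_nonneg_right hA hΨ0
      rw [pow_succ]
      linarith
  have hTn : T ≤ n * (δ / 2) := by
    rw [div_lt_iff₀ (by positivity)] at hn
    exact hn.le
  exact (hle T ⟨hT, le_rfl⟩).trans (hstep n T ⟨hT, le_rfl⟩ hTn)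

lemma MeasureTheory.MemLp.continuous_smul_Icc {E : Type*} [NormedAddCommGroup E]
    [NormedSpace ℝ E] {a b : ℝ} {c : ℝ → ℝ} (hc : Continuous c) {f : ℝ → E}
    (hf : MemLp f 2 (volume.restrict (Icc a b))) :
    MemLp (fun s => c s • f s) 2 (volume.restrict (Icc a b)) := by
  obtain ⟨R, hR⟩ := isCompact_Icc.exists_bound_of_continuousOn (hc.continuousOn (s := Icc a b))
  refine hf.of_le_mul (c := R) (hc.aestronglyMeasurable.smul hf.1) ?_
  filter_upwards [ae_restrict_mem measurableSet_Icc] with s hs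
  rw [norm_smul]
  exact mul_le_mul_of_nonneg_right (hR s hs) (norm_nonneg _)

lemma Continuous.memLp_Icc {E : Type*} [NormedAddCommGroup E] {a b : ℝ} {f : ℝ → E}
    (hf : Continuous f) : MemLp f 2 (volume.restrict (Icc a b)) := by
  obtain ⟨R, hR⟩ := isCompact_Icc.exists_bound_of_continuousOn (hf.continuousOn (s := Icc a b))
  refine MemLp.of_bound hf.aestronglyMeasurable R ?_
  filter_upwards [ae_restrict_mem measurableSet_Icc] with s hs using hR s hs

/-! ### The abstract equation and its stability -/

section Abstract

variable {V H M : Type*} [NormedAddCommGroup V] [InnerProductSpace ℝ V]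
  [NormedAddCommGroup H] [InnerProductSpace ℝ H] [NormedAddCommGroup M] [InnerProductSpace ℝ M]

/-- The data of the convective term: `ι` is the embedding of `V` into `H`, `D` the gradient and
`B u w` the tensor product `u ⊗ w`, so that the trilinear form is
`b(u, v, w) = ⟪B u w, D v⟫`. -/
structure IsConvective (ι : V →L[ℝ] H) (D : V →L[ℝ] M) (B : V →L[ℝ] V →L[ℝ] M) (C : ℝ) :
    Prop where
  nonneg : 0 ≤ C
  norm_self_le : ∀ u, ‖B u u‖ ≤ C * ‖ι u‖ * ‖D u‖
  inner_self : ∀ u v, inner ℝ (B u v) (D v) = 0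

/-- Weak solutions on `[0, T]` in the abstract setting, with a coefficient path `z`. -/
structure IsWeakSolutionOn (ι : V →L[ℝ] H) (D : V →L[ℝ] M) (B : V →L[ℝ] V →L[ℝ] M)
    (ν σ : ℝ) (z : ℝ → ℝ) (g : ℝ → H) (T : ℝ) (y : ℝ → H) (Y : ℝ → V) : Prop where
  continuous : Continuous y
  memLp : MemLp Y 2 (volume.restrict (Icc 0 T))
  ae_eq : ∀ᵐ t ∂(volume.restrict (Icc 0 T)), ι (Y t) = y t
  weak_eq : ∀ φ : V, ∀ t ∈ Icc 0 T, inner ℝ (y t) (ι φ) = inner ℝ (y 0) (ι φ) +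
    ∫ s in (0 : ℝ)..t, (-(ν * inner ℝ (D (Y s)) (D φ))
      - Real.exp (z s) * inner ℝ (B (Y s) φ) (D (Y s))
      + Real.exp (-z s) * inner ℝ (g s) (ι φ) + σ * z s * inner ℝ (y s) (ι φ))

/-- Polarization of `inner_self`. -/
lemma IsConvective.inner_swap {ι : V →L[ℝ] H} {D : V →L[ℝ] M} {B : V →L[ℝ] V →L[ℝ] M} {C : ℝ}
    (hB : IsConvective ι D B C) (u v w : V) :
    inner ℝ (B u v) (D w) = -inner ℝ (B u w) (D v) := by
  have h := hB.inner_self u (v + w)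
  simp only [map_add, inner_add_left, inner_add_right, hB.inner_self] at h
  linarith

/-- The right-hand side of the equation as a functional on `V`. -/
def forceFunctional (ι : V →L[ℝ] H) (D : V →L[ℝ] M) (m : M) (n : H) : V →L[ℝ] ℝ :=
  (innerSL ℝ m).comp D + (innerSL ℝ n).comp ι

lemma forceFunctional_apply (ι : V →L[ℝ] H) (D : V →L[ℝ] M) (m : M) (n : H) (φ : V) :
    forceFunctional ι D m n φ = inner ℝ m (D φ) + inner ℝ n (ι φ) := by
  simp [forceFunctional]

lemma continuous_forceFunctional (ι : V →L[ℝ] H) (D : V →L[ℝ] M) :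
    Continuous fun p : M × H => forceFunctional ι D p.1 p.2 :=
  (((innerSL ℝ (E := M)).continuous.comp continuous_fst).clm_comp continuous_const).add
    (((innerSL ℝ (E := H)).continuous.comp continuous_snd).clm_comp continuous_const)

lemma norm_forceFunctional_le (ι : V →L[ℝ] H) (D : V →L[ℝ] M) (m : M) (n : H) :
    ‖forceFunctional ι D m n‖ ≤ ‖(‖m‖ * ‖D‖ + ‖n‖ * ‖ι‖)‖ := by
  rw [Real.norm_of_nonneg (by positivity)]
  refine (norm_add_le _ _).trans (add_le_add ?_ ?_) <;>
  · refine (ContinuousLinearMap.opNorm_comp_le _ _).trans ?_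
    rw [innerSL_apply_norm]

lemma memLp_forceFunctional (ι : V →L[ℝ] H) (D : V →L[ℝ] M) {μ : Measure ℝ} {m : ℝ → M}
    {n : ℝ → H} (hm : MemLp m 2 μ) (hn : MemLp n 2 μ) :
    MemLp (fun s => forceFunctional ι D (m s) (n s)) 2 μ :=
  ((hm.norm.mul_const ‖D‖).add (hn.norm.mul_const ‖ι‖)).mono
    ((continuous_forceFunctional ι D).comp_aestronglyMeasurable₂ hm.1 hn.1)
    (Eventually.of_forall fun _ => norm_forceFunctional_le ι D _ _)

namespace IsWeakSolutionOn

variable {ι : V →L[ℝ] H} {D : V →L[ℝ] M} {B : V →L[ℝ] V →L[ℝ] M} {C ν σ T : ℝ} {z : ℝ → ℝ}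
  {g g₁ g₂ : ℝ → H} {y y₁ y₂ : ℝ → H} {Y Y₁ Y₂ : ℝ → V}

/-- The diagonal bound on `B` is linear in `‖D u‖`, and `‖ι u‖` stays bounded on `[0, T]` by
continuity in `H`. So the convective stress is as integrable in time as the gradient, which puts the
weak derivative in `L²(V')`. -/
lemma memLp_stress (hB : IsConvective ι D B C) (hz : Continuous z)
    (h : IsWeakSolutionOn ι D B ν σ z g T y Y) :
    MemLp (fun s => -(ν • D (Y s)) + Real.exp (z s) • B (Y s) (Y s)) 2
      (volume.restrict (Icc 0 T)) := by
  have hD : MemLp (fun s => D (Y s)) 2 (volume.restrict (Icc 0 T)) := D.comp_memLp' h.memLp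
  refine (hD.const_smul ν).neg.add (MemLp.continuous_smul_Icc (by fun_prop) ?_)
  obtain ⟨R, hR⟩ := isCompact_Icc.exists_bound_of_continuousOn
    (h.continuous.continuousOn (s := Icc 0 T))
  refine hD.of_le_mul (c := C * R) ?_ ?_
  · exact (show Continuous fun u : V => B u u by fun_prop).comp_aestronglyMeasurable h.memLp.1
  · filter_upwards [ae_restrict_mem measurableSet_Icc, h.ae_eq] with s hs hsy
    refine (hB.norm_self_le _).trans ?_
    rw [hsy]
    have := hB.nonneg
    have := hR s hs
    gcongr

lemma memLp_force (hz : Continuous z) (hg : MemLp g 2 (volume.restrict (Icc 0 T)))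
    (h : IsWeakSolutionOn ι D B ν σ z g T y Y) :
    MemLp (fun s => Real.exp (-z s) • g s + (σ * z s) • y s) 2 (volume.restrict (Icc 0 T)) :=
  (MemLp.continuous_smul_Icc (by fun_prop) hg).add
    (MemLp.continuous_smul_Icc (by fun_prop) h.continuous.memLp_Icc)

/-- Antisymmetry moves the gradient onto the test vector, so that the stress acts through `D φ`;
this accounts for the change of sign of the convective term. -/
lemma weak_eq_forceFunctional (hB : IsConvective ι D B C)
    (h : IsWeakSolutionOn ι D B ν σ z g T y Y) (φ : V) {t : ℝ} (ht : t ∈ Icc 0 T) :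
    inner ℝ (y t) (ι φ) = inner ℝ (y 0) (ι φ) + ∫ s in (0 : ℝ)..t,
      forceFunctional ι D (-(ν • D (Y s)) + Real.exp (z s) • B (Y s) (Y s))
        (Real.exp (-z s) • g s + (σ * z s) • y s) φ := by
  rw [h.weak_eq φ t ht]
  congr 1
  refine intervalIntegral.integral_congr fun s _ => ?_
  simp only [forceFunctional_apply, inner_add_left, inner_neg_left, real_inner_smul_left]
  rw [hB.inner_swap (Y s) φ (Y s)]
  ring

/-- The pointwise estimate of the energy production of a difference of two solutions. -/
lemma pairing_difference_le (hB : IsConvective ι D B C) (hν : 0 < ν) (hσ : 0 < σ)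
    (u₁ u₂ : V) (γ₁ γ₂ : H) (ζ : ℝ) :
    2 * (forceFunctional ι D (-(ν • D u₁) + Real.exp ζ • B u₁ u₁)
          (Real.exp (-ζ) • γ₁ + (σ * ζ) • ι u₁)
        - forceFunctional ι D (-(ν • D u₂) + Real.exp ζ • B u₂ u₂)
          (Real.exp (-ζ) • γ₂ + (σ * ζ) • ι u₂)) (u₁ - u₂) ≤
      (C ^ 2 * Real.exp ζ ^ 2 * ‖D u₂‖ ^ 2 / (2 * ν) + Real.exp (-ζ) ^ 2 + 2 * σ * |ζ|)
        * ‖ι (u₁ - u₂)‖ ^ 2 + ‖γ₁ - γ₂‖ ^ 2 := by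
  obtain ⟨w, rfl⟩ : ∃ w, u₁ = u₂ + w := ⟨u₁ - u₂, by abel⟩
  have e : u₂ + w - u₂ = w := by abel
  rw [e, sub_apply, forceFunctional_apply, forceFunctional_apply]
  -- Expanding bilinearly, `⟪B u₂ w, D w⟫` and `⟪B w w, D w⟫` vanish. What remains puts the
  -- derivative on `u₂` alone.
  have e1 : inner ℝ (B (u₂ + w) (u₂ + w)) (D w) - inner ℝ (B u₂ u₂) (D w) =
      -inner ℝ (B w w) (D u₂) := by
    rw [hB.inner_swap w w u₂]
    simp only [map_add, add_apply, inner_add_left, hB.inner_self]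
    ring
  have e2 : 2 * ((inner ℝ (-(ν • D (u₂ + w)) + Real.exp ζ • B (u₂ + w) (u₂ + w)) (D w)
        + inner ℝ (Real.exp (-ζ) • γ₁ + (σ * ζ) • ι (u₂ + w)) (ι w))
      - (inner ℝ (-(ν • D u₂) + Real.exp ζ • B u₂ u₂) (D w)
        + inner ℝ (Real.exp (-ζ) • γ₂ + (σ * ζ) • ι u₂) (ι w))) =
      -(2 * ν * ‖D w‖ ^ 2) - 2 * Real.exp ζ * inner ℝ (B w w) (D u₂)
        + 2 * Real.exp (-ζ) * inner ℝ (γ₁ - γ₂) (ι w) + 2 * σ * ζ * ‖ι w‖ ^ 2 := by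
    have e3 : inner ℝ (B w w) (D u₂) =
      inner ℝ (B u₂ u₂) (D w) - inner ℝ (B (u₂ + w) (u₂ + w)) (D w) := by linarith
    rw [e3]
    simp only [map_add D, map_add ι, inner_add_left, inner_neg_left, inner_sub_left,
      real_inner_smul_left, real_inner_self_eq_norm_sq, smul_add]
    ring
  rw [e2]
  have b1 : |inner ℝ (B w w) (D u₂)| ≤ C * ‖ι w‖ * ‖D w‖ * ‖D u₂‖ :=
    (abs_real_inner_le_norm _ _).trans
      (mul_le_mul_of_nonneg_right (hB.norm_self_le w) (norm_nonneg _))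
  have b2 : inner ℝ (γ₁ - γ₂) (ι w) ≤ ‖γ₁ - γ₂‖ * ‖ι w‖ := real_inner_le_norm _ _
  have p1 := Real.exp_pos ζ
  have p2 := Real.exp_pos (-ζ)
  -- Young's inequality, weighted to use up exactly the dissipation `2ν‖D w‖²`.
  have c1 : -(2 * Real.exp ζ * inner ℝ (B w w) (D u₂)) ≤
      2 * ν * ‖D w‖ ^ 2 + C ^ 2 * Real.exp ζ ^ 2 * ‖D u₂‖ ^ 2 / (2 * ν) * ‖ι w‖ ^ 2 := by
    have q1 : -(2 * Real.exp ζ * inner ℝ (B w w) (D u₂)) ≤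
        2 * (Real.exp ζ * C * ‖ι w‖ * ‖D u₂‖) * ‖D w‖ := by
      have := mul_le_mul_of_nonneg_left ((neg_le_abs _).trans b1) p1.le
      linarith
    refine q1.trans ?_
    set p := Real.exp ζ * C * ‖ι w‖ * ‖D u₂‖ with hp
    have q2 : C ^ 2 * Real.exp ζ ^ 2 * ‖D u₂‖ ^ 2 / (2 * ν) * ‖ι w‖ ^ 2 = p ^ 2 / (2 * ν) := by
      rw [hp]; ring
    rw [q2]
    have q3 : 2 * ν * ‖D w‖ ^ 2 + p ^ 2 / (2 * ν) - 2 * p * ‖D w‖ =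
        (2 * ν * ‖D w‖ - p) ^ 2 / (2 * ν) := by field_simp; ring
    have q4 : 0 ≤ (2 * ν * ‖D w‖ - p) ^ 2 / (2 * ν) := by positivity
    linarith
  have c2 : 2 * Real.exp (-ζ) * inner ℝ (γ₁ - γ₂) (ι w) ≤
      Real.exp (-ζ) ^ 2 * ‖ι w‖ ^ 2 + ‖γ₁ - γ₂‖ ^ 2 := by
    have := mul_le_mul_of_nonneg_left b2 p2.le
    nlinarith [sq_nonneg (Real.exp (-ζ) * ‖ι w‖ - ‖γ₁ - γ₂‖)]
  have c3 : 2 * σ * ζ * ‖ι w‖ ^ 2 ≤ 2 * σ * |ζ| * ‖ι w‖ ^ 2 := by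
    have := le_abs_self ζ
    gcongr
  nlinarith

/-- Continuous dependence of weak solutions on the initial value and on the force. -/
theorem exists_stability_const (hB : IsConvective ι D B C) (hν : 0 < ν) (hσ : 0 < σ)
    (hT : 0 ≤ T) (hz : Continuous z) (hg₂ : MemLp g₂ 2 (volume.restrict (Icc 0 T)))
    (h₂ : IsWeakSolutionOn ι D B ν σ z g₂ T y₂ Y₂) :
    ∃ K : ℝ, ∀ (g₁ y₁ : ℝ → H) (Y₁ : ℝ → V), MemLp g₁ 2 (volume.restrict (Icc 0 T)) →
      IsWeakSolutionOn ι D B ν σ z g₁ T y₁ Y₁ →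
      ‖y₁ T - y₂ T‖ ^ 2 ≤
        K * (‖y₁ 0 - y₂ 0‖ ^ 2 + ∫ s in (0 : ℝ)..T, ‖g₁ s - g₂ s‖ ^ 2) := by
  -- The coefficient from `pairing_difference_le` involves only the second solution, so `K` can be
  -- fixed before the first one is given.
  set a : ℝ → ℝ := fun s => C ^ 2 * Real.exp (z s) ^ 2 * ‖D (Y₂ s)‖ ^ 2 / (2 * ν)
    + Real.exp (-z s) ^ 2 + 2 * σ * |z s| with ha
  have ha0 : ∀ s, 0 ≤ a s := fun s => by positivity
  have hai : IntegrableOn a (Icc 0 T) := by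
    have h1 : MemLp (fun s => Real.exp (z s) • D (Y₂ s)) 2 (volume.restrict (Icc 0 T)) :=
      MemLp.continuous_smul_Icc (by fun_prop) (D.comp_memLp' h₂.memLp)
    have h2 : IntegrableOn (fun s => Real.exp (-z s) ^ 2 + 2 * σ * |z s|) (Icc 0 T) :=
      (show Continuous fun s => Real.exp (-z s) ^ 2 + 2 * σ * |z s| by fun_prop).integrableOn_Icc
    refine ((h1.integrable_norm_pow (by norm_num)).const_mul (C ^ 2 / (2 * ν))).add h2
      |>.congr (Eventually.of_forall fun s => ?_)
    simp only [ha, Pi.add_apply, norm_smul, Real.norm_of_nonneg (Real.exp_pos _).le]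
    ring
  obtain ⟨K, hK⟩ := exists_gronwall_const hT ha0 hai
  refine ⟨K, fun g₁ y₁ Y₁ hg₁ h₁ => ?_⟩
  refine hK _ (fun t => ‖y₁ t - y₂ t‖ ^ 2) ?_ (fun s => by positivity) fun t ht => ?_
  · have := h₁.continuous
    have := h₂.continuous
    fun_prop
  set F₁ : ℝ → V →L[ℝ] ℝ := fun s => forceFunctional ι D
    (-(ν • D (Y₁ s)) + Real.exp (z s) • B (Y₁ s) (Y₁ s))
    (Real.exp (-z s) • g₁ s + (σ * z s) • y₁ s) with hF₁
  set F₂ : ℝ → V →L[ℝ] ℝ := fun s => forceFunctional ι D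
    (-(ν • D (Y₂ s)) + Real.exp (z s) • B (Y₂ s) (Y₂ s))
    (Real.exp (-z s) • g₂ s + (σ * z s) • y₂ s) with hF₂
  have hle : volume.restrict (Icc 0 t) ≤ volume.restrict (Icc 0 T) :=
    Measure.restrict_mono (Icc_subset_Icc_right ht.2) le_rfl
  have mF₁ : MemLp F₁ 2 (volume.restrict (Icc 0 T)) :=
    memLp_forceFunctional ι D (h₁.memLp_stress hB hz) (h₁.memLp_force hz hg₁)
  have mF₂ : MemLp F₂ 2 (volume.restrict (Icc 0 T)) :=
    memLp_forceFunctional ι D (h₂.memLp_stress hB hz) (h₂.memLp_force hz hg₂)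
  have mF : MemLp (fun s => F₁ s - F₂ s) 2 (volume.restrict (Icc 0 T)) := mF₁.sub mF₂
  have mW : MemLp (fun s => Y₁ s - Y₂ s) 2 (volume.restrict (Icc 0 T)) := h₁.memLp.sub h₂.memLp
  have hFi : ∀ F : ℝ → V →L[ℝ] ℝ, MemLp F 2 (volume.restrict (Icc 0 T)) → ∀ φ : V,
      ∀ r ∈ Icc 0 T, IntervalIntegrable (fun s => F s φ) volume 0 r := by
    intro F hF φ r hr
    have : IntegrableOn (fun s => F s φ) (Icc 0 T) :=
      (hF.integrable (by norm_num)).apply_continuousLinearMap φ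
    exact (this.mono_set (uIcc_subset_Icc ⟨le_rfl, hT⟩ hr)).intervalIntegrable
  have energy := norm_sq_eq_of_weak_derivative ι ht.1 (w := fun s => y₁ s - y₂ s)
    (h₁.continuous.sub h₂.continuous) (W := fun s => Y₁ s - Y₂ s) (mW.mono_measure hle)
    (by
      filter_upwards [ae_mono hle h₁.ae_eq, ae_mono hle h₂.ae_eq] with s hs1 hs2
      rw [map_sub, hs1, hs2])
    (G := fun s => F₁ s - F₂ s) (mF.mono_measure hle)
    (by
      intro φ r hr
      have hrT : r ∈ Icc 0 T := ⟨hr.1, hr.2.trans ht.2⟩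
      simp only [sub_apply]
      rw [inner_sub_left, inner_sub_left, h₁.weak_eq_forceFunctional hB φ hrT,
        h₂.weak_eq_forceFunctional hB φ hrT,
        intervalIntegral.integral_sub (hFi F₁ mF₁ φ r hrT) (hFi F₂ mF₂ φ r hrT)]
      ring)
  have mg : MemLp (fun s => g₁ s - g₂ s) 2 (volume.restrict (Icc 0 T)) := hg₁.sub hg₂
  have ig : IntegrableOn (fun s => ‖g₁ s - g₂ s‖ ^ 2) (Icc 0 T) :=
    mg.integrable_norm_pow (by norm_num)
  have iag : IntervalIntegrable (fun s => a s * ‖y₁ s - y₂ s‖ ^ 2) volume 0 t := by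
    refine ((hai.mono_set (uIcc_subset_Icc ⟨le_rfl, hT⟩ ht)).intervalIntegrable).mul_continuousOn ?_
    exact ((h₁.continuous.sub h₂.continuous).norm.pow 2).continuousOn
  have igt : IntervalIntegrable (fun s => ‖g₁ s - g₂ s‖ ^ 2) volume 0 t :=
    (ig.mono_set (uIcc_subset_Icc ⟨le_rfl, hT⟩ ht)).intervalIntegrable
  have hpair : 2 * ∫ s in (0 : ℝ)..t, (F₁ s - F₂ s) (Y₁ s - Y₂ s) ≤
      ∫ s in (0 : ℝ)..t, (a s * ‖y₁ s - y₂ s‖ ^ 2 + ‖g₁ s - g₂ s‖ ^ 2) := by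
    rw [← intervalIntegral.integral_const_mul]
    refine intervalIntegral.integral_mono_ae_restrict ht.1 ?_ (iag.add igt) ?_
    · have h1 : IntegrableOn (fun s => ‖F₁ s - F₂ s‖ * ‖Y₁ s - Y₂ s‖) (Icc 0 T) :=
        MemLp.integrable_mul mF.norm mW.norm
      have h2 : IntegrableOn (fun s => (F₁ s - F₂ s) (Y₁ s - Y₂ s)) (Icc 0 T) :=
        h1.mono' (isBoundedBilinearMap_apply.continuous.comp_aestronglyMeasurable₂ mF.1 mW.1)
          (Eventually.of_forall fun s => (F₁ s - F₂ s).le_opNorm _)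
      exact ((h2.mono_set (uIcc_subset_Icc ⟨le_rfl, hT⟩ ht)).intervalIntegrable).const_mul 2
    · filter_upwards [ae_mono hle h₁.ae_eq, ae_mono hle h₂.ae_eq] with s hs1 hs2
      have := pairing_difference_le hB hν hσ (Y₁ s) (Y₂ s) (g₁ s) (g₂ s) (z s)
      rw [map_sub ι, hs1, hs2] at this
      exact this
  rw [intervalIntegral.integral_add iag igt] at hpair
  -- Grönwall is applied with a datum `d` independent of `t`, so the force is integrated up to `T`.
  have hgmono : ∫ s in (0 : ℝ)..t, ‖g₁ s - g₂ s‖ ^ 2 ≤ ∫ s in (0 : ℝ)..T, ‖g₁ s - g₂ s‖ ^ 2 := by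
    rw [intervalIntegral.integral_of_le ht.1, intervalIntegral.integral_of_le hT]
    exact setIntegral_mono_set (ig.mono_set Ioc_subset_Icc_self)
      (Eventually.of_forall fun s => by positivity)
      (Ioc_subset_Ioc_right ht.2).eventuallyLE
  linarith

end IsWeakSolutionOn

end Abstract

/-! ### Test fields -/

lemma planePartial_add {φ ψ : Plane → Plane} (hφ : Differentiable ℝ φ) (hψ : Differentiable ℝ ψ)
    (i j : Fin 2) (x : Plane) :
    planePartial (φ + ψ) i j x = planePartial φ i j x + planePartial ψ i j x := by
  simp [planePartial, fderiv_add (hφ x) (hψ x)]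

lemma planePartial_smul {φ : Plane → Plane} (hφ : Differentiable ℝ φ) (c : ℝ)
    (i j : Fin 2) (x : Plane) :
    planePartial (c • φ) i j x = c * planePartial φ i j x := by
  simp [planePartial, fderiv_const_smul (hφ x)]

lemma planeGrad_add {φ ψ : Plane → Plane} (hφ : Differentiable ℝ φ) (hψ : Differentiable ℝ ψ)
    (x : Plane) : planeGrad (φ + ψ) x = planeGrad φ x + planeGrad ψ x := by
  ext p
  exact planePartial_add hφ hψ p.1 p.2 x

lemma planeGrad_smul {φ : Plane → Plane} (hφ : Differentiable ℝ φ) (c : ℝ) (x : Plane) :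
    planeGrad (c • φ) x = c • planeGrad φ x := by
  ext p
  exact planePartial_smul hφ c p.1 p.2 x

section TestField

variable {𝒪 : Set Plane} {φ ψ : Plane → Plane}

lemma differentiable_of_mem_divFreeTestFields (hφ : φ ∈ divFreeTestFields 𝒪) :
    Differentiable ℝ φ := hφ.1.differentiable (by simp)

lemma zero_mem_divFreeTestFields : (0 : Plane → Plane) ∈ divFreeTestFields 𝒪 := by
  refine ⟨contDiff_const, HasCompactSupport.zero, by simp [tsupport], fun x => ?_⟩
  have : fderiv ℝ (0 : Plane → Plane) x = 0 := by
    rw [show (0 : Plane → Plane) = fun _ => 0 from rfl, fderiv_fun_const]; rfl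
  simp [planePartial, this]

lemma add_mem_divFreeTestFields (hφ : φ ∈ divFreeTestFields 𝒪) (hψ : ψ ∈ divFreeTestFields 𝒪) :
    φ + ψ ∈ divFreeTestFields 𝒪 := by
  refine ⟨hφ.1.add hψ.1, hφ.2.1.add hψ.2.1, ?_, fun x => ?_⟩
  · exact (tsupport_add φ ψ).trans (union_subset hφ.2.2.1 hψ.2.2.1)
  · simp_rw [planePartial_add (differentiable_of_mem_divFreeTestFields hφ)
      (differentiable_of_mem_divFreeTestFields hψ), Finset.sum_add_distrib]
    rw [hφ.2.2.2 x, hψ.2.2.2 x, add_zero]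

lemma smul_mem_divFreeTestFields (c : ℝ) (hφ : φ ∈ divFreeTestFields 𝒪) :
    c • φ ∈ divFreeTestFields 𝒪 := by
  refine ⟨contDiff_const.smul hφ.1, hφ.2.1.smul_left (f := fun _ => c), ?_, fun x => ?_⟩
  · exact (closure_mono (Function.support_const_smul_subset c φ)).trans hφ.2.2.1
  · simp_rw [planePartial_smul (differentiable_of_mem_divFreeTestFields hφ), ← Finset.mul_sum]
    rw [hφ.2.2.2 x, mul_zero]

lemma continuous_planePartial (hφ : φ ∈ divFreeTestFields 𝒪) (i j : Fin 2) :
    Continuous (planePartial φ i j) := by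
  have h1 : Continuous (fderiv ℝ φ) := hφ.1.continuous_fderiv (by simp)
  have h2 : Continuous fun x => fderiv ℝ φ x (EuclideanSpace.single i 1) :=
    h1.clm_apply continuous_const
  unfold planePartial
  fun_prop

lemma continuous_planeGrad (hφ : φ ∈ divFreeTestFields 𝒪) : Continuous (planeGrad φ) :=
  (PiLp.continuous_toLp 2 _).comp
    (continuous_pi fun p => continuous_planePartial hφ p.1 p.2)

lemma planeGrad_eq_zero_of_notMem_tsupport {x : Plane} (hx : x ∉ tsupport φ) :
    planeGrad φ x = 0 := by
  ext p
  simp [planeGrad, planePartial, fderiv_of_notMem_tsupport ℝ hx]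

lemma norm_fderiv_le_planeGrad (x : Plane) : ‖fderiv ℝ φ x‖ ≤ 2 * ‖planeGrad φ x‖ := by
  have hcol : ∀ i : Fin 2, ‖fderiv ℝ φ x (EuclideanSpace.single i 1)‖ ≤ ‖planeGrad φ x‖ := by
    intro i
    refine le_of_sq_le_sq ?_ (norm_nonneg _)
    rw [EuclideanSpace.norm_sq_eq, EuclideanSpace.norm_sq_eq, Fintype.sum_prod_type]
    exact Finset.single_le_sum
      (f := fun i : Fin 2 => ∑ j : Fin 2, ‖(planeGrad φ x) (i, j)‖ ^ 2)
      (fun i _ => by positivity) (Finset.mem_univ i)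
  refine ContinuousLinearMap.opNorm_le_bound _ (by positivity) fun v => ?_
  have hv : v = ∑ i : Fin 2, v i • EuclideanSpace.single i (1 : ℝ) := by
    ext j
    fin_cases j <;> simp
  calc ‖fderiv ℝ φ x v‖
      = ‖∑ i : Fin 2, v i • fderiv ℝ φ x (EuclideanSpace.single i 1)‖ := by
        conv_lhs => rw [hv]
        simp only [map_sum, map_smul]
    _ ≤ ∑ i : Fin 2, ‖v i • fderiv ℝ φ x (EuclideanSpace.single i 1)‖ := norm_sum_le _ _
    _ ≤ ∑ _i : Fin 2, ‖v‖ * ‖planeGrad φ x‖ := by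
        refine Finset.sum_le_sum fun i _ => ?_
        rw [norm_smul]
        exact mul_le_mul (PiLp.norm_apply_le v i) (hcol i) (norm_nonneg _) (norm_nonneg _)
    _ = 2 * ‖planeGrad φ x‖ * ‖v‖ := by simp; ring

/-- A constant for the planar Ladyzhenskaya inequality. -/
def ladyzhenskayaConst : ℝ≥0 :=
  4 * eLpNormLESNormFDerivOneConst (volume : Measure Plane) ((2 : ℝ≥0) : ℝ)

/-- The `L¹` Gagliardo-Nirenberg-Sobolev inequality applied to `|φ|²`: in dimension two it bounds
`‖|φ|²‖₂ = ‖φ‖₄²` by `‖∇|φ|²‖₁`, and Cauchy-Schwarz splits the product `|φ| |∇φ|`. -/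
theorem eLpNorm_four_sq_le (hφ : φ ∈ divFreeTestFields 𝒪) :
    eLpNorm φ 4 (volume.restrict 𝒪) ^ 2 ≤ ladyzhenskayaConst *
      (eLpNorm φ 2 (volume.restrict 𝒪) * eLpNorm (planeGrad φ) 2 (volume.restrict 𝒪)) := by
  have hs1 : Function.support φ ⊆ 𝒪 := (subset_tsupport φ).trans hφ.2.2.1
  have hs2 : Function.support (planeGrad φ) ⊆ 𝒪 := by
    intro x hx
    by_contra hxO
    exact hx (planeGrad_eq_zero_of_notMem_tsupport fun h => hxO (hφ.2.2.1 h))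
  rw [eLpNorm_restrict_eq_of_support_subset hs1, eLpNorm_restrict_eq_of_support_subset hs1,
    eLpNorm_restrict_eq_of_support_subset hs2]
  set u : Plane → ℝ := fun x => ‖φ x‖ ^ 2 with hu
  have hud : ContDiff ℝ 1 u := (hφ.1.of_le (by simp)).norm_sq ℝ
  have hus : HasCompactSupport u := hφ.2.1.comp_left (g := fun y => ‖y‖ ^ 2) (by simp)
  have hcon : NNReal.HolderConjugate (Module.finrank ℝ Plane : ℝ≥0) 2 := by
    rw [finrank_euclideanSpace, Fintype.card_fin]
    exact_mod_cast NNReal.HolderConjugate.two_two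
  have gns := eLpNorm_le_eLpNorm_fderiv_one (volume : Measure Plane) hud hus hcon
  have e1 : eLpNorm u (2 : ℝ≥0) volume = eLpNorm φ 4 volume ^ 2 := by
    have h := eLpNorm_norm_rpow (p := 2) (μ := (volume : Measure Plane)) φ
      (q := 2) (by norm_num)
    rw [show (2 : ℝ≥0∞) * ENNReal.ofReal 2 = 4 by norm_num] at h
    simpa using h
  -- One factor 2 comes from differentiating the square, the other from `norm_fderiv_le_planeGrad`.
  have e2 : eLpNorm (fderiv ℝ u) 1 volume ≤
      4 * (eLpNorm φ 2 volume * eLpNorm (planeGrad φ) 2 volume) := by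
    rw [eLpNorm_one_eq_lintegral_enorm]
    calc ∫⁻ x, ‖fderiv ℝ u x‖ₑ ≤ ∫⁻ x, 4 * (‖φ x‖ₑ * ‖planeGrad φ x‖ₑ) := by
          refine lintegral_mono fun x => ?_
          have hx : ‖fderiv ℝ u x‖ ≤ 4 * (‖φ x‖ * ‖planeGrad φ x‖) := by
            rw [((differentiable_of_mem_divFreeTestFields hφ x).hasFDerivAt.norm_sq).fderiv]
            refine (norm_nsmul_le).trans ?_
            have h1 := ContinuousLinearMap.opNorm_comp_le (innerSL ℝ (φ x)) (fderiv ℝ φ x)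
            rw [innerSL_apply_norm] at h1
            have h2 := mul_le_mul_of_nonneg_left (norm_fderiv_le_planeGrad (φ := φ) x)
              (norm_nonneg (φ x))
            push_cast
            linarith
          have := ENNReal.ofReal_le_ofReal hx
          rwa [ENNReal.ofReal_mul (by norm_num), ENNReal.ofReal_mul (norm_nonneg _), ofReal_norm,
            ofReal_norm, ofReal_norm, show ENNReal.ofReal 4 = 4 by norm_num] at this
      _ ≤ _ := by
          rw [lintegral_const_mul' _ _ (by simp)]
          gcongr
          exact lintegral_enorm_mul_le_eLpNorm_mul hφ.1.continuous.aestronglyMeasurable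
            (continuous_planeGrad hφ).aestronglyMeasurable
  rw [← e1]
  refine gns.trans ?_
  rw [ladyzhenskayaConst, ENNReal.coe_mul]
  refine (mul_le_mul_right e2 _).trans_eq ?_
  push_cast
  ring

end TestField

/-! ### Density of test fields and Ladyzhenskaya's inequality on `𝕍` -/

section Spaces

variable {𝒪 : Set Plane}

/-- `U ∈ 𝕍` is given by the test field `φ`. -/
def RepresentsTestField (φ : Plane → Plane) (U : WithLp 2 (VectorL2 𝒪 × MatrixL2 𝒪)) : Prop :=
  φ ∈ divFreeTestFields 𝒪 ∧ U.fst =ᵐ[volume.restrict 𝒪] φ ∧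
    U.snd =ᵐ[volume.restrict 𝒪] planeGrad φ

/-- Test fields already form a vector space on which the gradient is linear, so elements of `𝕍` are
limits of single test fields rather than of formal combinations. -/
lemma exists_representsTestField_of_mem_span {U : WithLp 2 (VectorL2 𝒪 × MatrixL2 𝒪)}
    (hU : U ∈ Submodule.span ℝ
      {u : WithLp 2 (VectorL2 𝒪 × MatrixL2 𝒪) | ∃ φ ∈ divFreeTestFields 𝒪,
        u.fst =ᵐ[volume.restrict 𝒪] φ ∧ u.snd =ᵐ[volume.restrict 𝒪] planeGrad φ}) :
    ∃ φ, RepresentsTestField φ U := by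
  induction hU using Submodule.span_induction with
  | mem x hx => exact hx
  | zero =>
    refine ⟨0, zero_mem_divFreeTestFields, Lp.coeFn_zero _ _ _, (Lp.coeFn_zero _ _ _).trans ?_⟩
    refine Eventually.of_forall fun x => ?_
    exact (planeGrad_eq_zero_of_notMem_tsupport (by simp [tsupport])).symm
  | add x y _ _ hx hy =>
    obtain ⟨φ, h1, h2, h3⟩ := hx
    obtain ⟨ψ, k1, k2, k3⟩ := hy
    refine ⟨φ + ψ, add_mem_divFreeTestFields h1 k1,
      (Lp.coeFn_add _ _).trans (h2.add k2), (Lp.coeFn_add _ _).trans ((h3.add k3).trans ?_)⟩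
    exact Eventually.of_forall fun x => (planeGrad_add
      (differentiable_of_mem_divFreeTestFields h1)
      (differentiable_of_mem_divFreeTestFields k1) x).symm
  | smul c x _ hx =>
    obtain ⟨φ, h1, h2, h3⟩ := hx
    refine ⟨c • φ, smul_mem_divFreeTestFields c h1,
      (Lp.coeFn_smul _ _).trans (h2.const_smul c),
      (Lp.coeFn_smul _ _).trans ((h3.const_smul c).trans ?_)⟩
    exact Eventually.of_forall fun x => (planeGrad_smul
      (differentiable_of_mem_divFreeTestFields h1) c x).symm

lemma exists_seq_testField (u : hydroV 𝒪) :
    ∃ (U : ℕ → hydroV 𝒪) (φ : ℕ → Plane → Plane),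
      (∀ n, RepresentsTestField (φ n) (U n).1) ∧ Tendsto U atTop (𝓝 u) := by
  obtain ⟨x, hx, hlim⟩ := mem_closure_iff_seq_limit.1 u.2
  choose φ hφ using fun n => exists_representsTestField_of_mem_span (hx n)
  exact ⟨fun n => ⟨x n, Submodule.le_topologicalClosure _ (hx n)⟩, φ, hφ,
    tendsto_subtype_rng.2 hlim⟩

/-- The embedding of `𝕍` into `L²`. -/
def fieldL (𝒪 : Set Plane) : hydroV 𝒪 →L[ℝ] VectorL2 𝒪 :=
  (WithLp.fstL 2 ℝ (VectorL2 𝒪) (MatrixL2 𝒪)).comp (hydroV 𝒪).subtypeL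

/-- The gradient on `𝕍`. -/
def gradL (𝒪 : Set Plane) : hydroV 𝒪 →L[ℝ] MatrixL2 𝒪 :=
  (WithLp.sndL 2 ℝ (VectorL2 𝒪) (MatrixL2 𝒪)).comp (hydroV 𝒪).subtypeL

lemma fieldL_apply (u : hydroV 𝒪) : fieldL 𝒪 u = u.1.fst := rfl

lemma gradL_apply (u : hydroV 𝒪) : gradL 𝒪 u = u.1.snd := rfl

lemma norm_fieldL_le (u : hydroV 𝒪) : ‖fieldL 𝒪 u‖ ≤ ‖u‖ := by
  refine le_of_sq_le_sq ?_ (norm_nonneg _)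
  have h := WithLp.prod_norm_sq_eq_of_L2 u.1
  rw [fieldL_apply, Submodule.coe_norm, h]
  nlinarith [sq_nonneg ‖u.1.snd‖]

lemma norm_gradL_le (u : hydroV 𝒪) : ‖gradL 𝒪 u‖ ≤ ‖u‖ := by
  refine le_of_sq_le_sq ?_ (norm_nonneg _)
  have h := WithLp.prod_norm_sq_eq_of_L2 u.1
  rw [gradL_apply, Submodule.coe_norm, h]
  nlinarith [sq_nonneg ‖u.1.fst‖]

/-- The planar Ladyzhenskaya inequality on `𝕍`. -/
theorem eLpNorm_four_fieldL_sq_le (u : hydroV 𝒪) :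
    eLpNorm (fieldL 𝒪 u) 4 (volume.restrict 𝒪) ^ 2 ≤
      ladyzhenskayaConst * (‖fieldL 𝒪 u‖ₑ * ‖gradL 𝒪 u‖ₑ) := by
  obtain ⟨U, φ, hφ, hU⟩ := exists_seq_testField u
  have hf : Tendsto (fun n => fieldL 𝒪 (U n)) atTop (𝓝 (fieldL 𝒪 u)) :=
    ((fieldL 𝒪).continuous.tendsto u).comp hU
  have hg : Tendsto (fun n => gradL 𝒪 (U n)) atTop (𝓝 (gradL 𝒪 u)) :=
    ((gradL 𝒪).continuous.tendsto u).comp hU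
  have hn : ∀ n, eLpNorm (fieldL 𝒪 (U n)) 4 (volume.restrict 𝒪) ^ 2 ≤
      ladyzhenskayaConst * (‖fieldL 𝒪 (U n)‖ₑ * ‖gradL 𝒪 (U n)‖ₑ) := by
    intro n
    obtain ⟨h1, h2, h3⟩ := hφ n
    rw [Lp.enorm_def, Lp.enorm_def, fieldL_apply, gradL_apply, eLpNorm_congr_ae h2,
      eLpNorm_congr_ae h2, eLpNorm_congr_ae h3]
    exact eLpNorm_four_sq_le h1
  -- Convergence in `𝕍` gives no `L⁴` convergence yet. Fatou along an almost everywhere convergent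
  -- subsequence suffices, since only lower semicontinuity of the `L⁴` norm is needed.
  obtain ⟨ns, hns, hae⟩ := (tendstoInMeasure_of_tendsto_Lp hf).exists_seq_tendsto_ae
  have hfatou := Lp.eLpNorm_lim_le_liminf_eLpNorm (p := 4) (μ := volume.restrict 𝒪)
    (fun n => Lp.aestronglyMeasurable (fieldL 𝒪 (U (ns n)))) _ hae
  have hroot : ∀ n, eLpNorm (fieldL 𝒪 (U (ns n))) 4 (volume.restrict 𝒪) ≤
      (ladyzhenskayaConst * (‖fieldL 𝒪 (U (ns n))‖ₑ * ‖gradL 𝒪 (U (ns n))‖ₑ)) ^ (1 / 2 : ℝ) := by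
    intro n
    rw [one_div, ENNReal.le_rpow_inv_iff (by norm_num)]
    exact_mod_cast hn (ns n)
  have hlim : Tendsto (fun n => ((ladyzhenskayaConst : ℝ≥0∞) *
      (‖fieldL 𝒪 (U (ns n))‖ₑ * ‖gradL 𝒪 (U (ns n))‖ₑ)) ^ (1 / 2 : ℝ)) atTop
      (𝓝 (((ladyzhenskayaConst : ℝ≥0∞) * (‖fieldL 𝒪 u‖ₑ * ‖gradL 𝒪 u‖ₑ)) ^ (1 / 2 : ℝ))) := by
    have h1 := (hf.comp hns.tendsto_atTop).enorm
    have h2 := (hg.comp hns.tendsto_atTop).enorm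
    exact (ENNReal.Tendsto.const_mul (ENNReal.Tendsto.mul h1 (Or.inr (by simp)) h2
      (Or.inr (by simp))) (Or.inr (by simp))).ennrpow_const _
  have := hfatou.trans ((liminf_le_liminf (Eventually.of_forall hroot)).trans_eq hlim.liminf_eq)
  rw [one_div, ENNReal.le_rpow_inv_iff (by norm_num)] at this
  exact_mod_cast this

lemma memLp_four_fieldL (u : hydroV 𝒪) : MemLp (fieldL 𝒪 u) 4 (volume.restrict 𝒪) := by
  refine ⟨Lp.aestronglyMeasurable _, ?_⟩
  by_contra h
  have h1 := eLpNorm_four_fieldL_sq_le u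
  rw [not_lt_top_iff.1 h] at h1
  have h2 : (ladyzhenskayaConst : ℝ≥0∞) * (‖fieldL 𝒪 u‖ₑ * ‖gradL 𝒪 u‖ₑ) < ∞ := by
    finiteness
  simp at h1
  exact h2.ne h1

/-! ### The tensor product of two fields -/

/-- The matrix `a ⊗ b`, as a vector of its entries. -/
def tensorVec (a b : Plane) : EuclideanSpace ℝ (Fin 2 × Fin 2) :=
  WithLp.toLp 2 fun p => a p.1 * b p.2

lemma norm_tensorVec (a b : Plane) : ‖tensorVec a b‖ = ‖a‖ * ‖b‖ := by
  rw [← sq_eq_sq₀ (norm_nonneg _) (by positivity), mul_pow]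
  simp_rw [EuclideanSpace.norm_sq_eq]
  rw [Fintype.sum_prod_type, Finset.sum_mul_sum]
  simp [tensorVec, mul_pow]

lemma continuous_tensorVec : Continuous fun p : Plane × Plane => tensorVec p.1 p.2 :=
  (PiLp.continuous_toLp 2 _).comp (by fun_prop)

instance holderTriple_four_four_two : ENNReal.HolderTriple 4 4 2 where
  inv_add_inv_eq_inv := by
    rw [show (4 : ℝ≥0∞) = 2 * 2 by norm_num, ENNReal.mul_inv (by simp) (by simp), ← mul_add,
      ENNReal.inv_two_add_inv_two, mul_one]

lemma eLpNorm_tensorVec_le (u w : hydroV 𝒪) :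
    eLpNorm (fun x => tensorVec (fieldL 𝒪 u x) (fieldL 𝒪 w x)) 2 (volume.restrict 𝒪) ≤
      eLpNorm (fieldL 𝒪 u) 4 (volume.restrict 𝒪) * eLpNorm (fieldL 𝒪 w) 4 (volume.restrict 𝒪) := by
  have := eLpNorm_le_eLpNorm_mul_eLpNorm'_of_norm (p := 4) (q := 4) (r := 2)
    (memLp_four_fieldL u).1 (memLp_four_fieldL w).1 tensorVec 1
    (Eventually.of_forall fun x => by simp [norm_tensorVec])
  simpa using this

lemma memLp_tensorVec (u w : hydroV 𝒪) :
    MemLp (fun x => tensorVec (fieldL 𝒪 u x) (fieldL 𝒪 w x)) 2 (volume.restrict 𝒪) :=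
  ⟨continuous_tensorVec.comp_aestronglyMeasurable₂ (memLp_four_fieldL u).1 (memLp_four_fieldL w).1,
    (eLpNorm_tensorVec_le u w).trans_lt
      (ENNReal.mul_lt_top (memLp_four_fieldL u).2 (memLp_four_fieldL w).2)⟩

/-- The tensor product `u ⊗ w` in `L²`. -/
def tensorL2 (u w : hydroV 𝒪) : MatrixL2 𝒪 := (memLp_tensorVec u w).toLp _

lemma coeFn_tensorL2 (u w : hydroV 𝒪) : tensorL2 u w =ᵐ[volume.restrict 𝒪]
    fun x => tensorVec (fieldL 𝒪 u x) (fieldL 𝒪 w x) :=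
  MemLp.coeFn_toLp _

/-- Hölder with exponents `4, 4, 2`, then Ladyzhenskaya for each factor. -/
lemma sq_norm_tensorL2_le (u w : hydroV 𝒪) :
    ‖tensorL2 u w‖ ^ 2 ≤ (ladyzhenskayaConst * (‖fieldL 𝒪 u‖ * ‖gradL 𝒪 u‖)) *
      (ladyzhenskayaConst * (‖fieldL 𝒪 w‖ * ‖gradL 𝒪 w‖)) := by
  have h : ‖tensorL2 u w‖ₑ ^ 2 ≤ (ladyzhenskayaConst * (‖fieldL 𝒪 u‖ₑ * ‖gradL 𝒪 u‖ₑ)) *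
      (ladyzhenskayaConst * (‖fieldL 𝒪 w‖ₑ * ‖gradL 𝒪 w‖ₑ)) := by
    rw [tensorL2, Lp.enorm_toLp]
    refine (pow_le_pow_left' (eLpNorm_tensorVec_le u w) 2).trans ?_
    rw [mul_pow]
    exact mul_le_mul' (eLpNorm_four_fieldL_sq_le u) (eLpNorm_four_fieldL_sq_le w)
  have h2 := ENNReal.toReal_mono (by finiteness) h
  simpa [ENNReal.toReal_mul] using h2

lemma norm_tensorL2_self_le (u : hydroV 𝒪) :
    ‖tensorL2 u u‖ ≤ ladyzhenskayaConst * ‖fieldL 𝒪 u‖ * ‖gradL 𝒪 u‖ := by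
  refine le_of_sq_le_sq ((sq_norm_tensorL2_le u u).trans_eq (by ring)) (by positivity)

lemma norm_tensorL2_le (u w : hydroV 𝒪) : ‖tensorL2 u w‖ ≤ ladyzhenskayaConst * ‖u‖ * ‖w‖ := by
  have key : ∀ v : hydroV 𝒪, ladyzhenskayaConst * (‖fieldL 𝒪 v‖ * ‖gradL 𝒪 v‖) ≤
      ladyzhenskayaConst * (‖v‖ * ‖v‖) := fun v =>
    mul_le_mul_of_nonneg_left (mul_le_mul (norm_fieldL_le v) (norm_gradL_le v) (norm_nonneg _)
      (norm_nonneg _)) (NNReal.coe_nonneg _)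
  have h := (sq_norm_tensorL2_le u w).trans
    (mul_le_mul (key u) (key w) (by positivity) (by positivity))
  exact le_of_sq_le_sq (h.trans_eq (by ring)) (by positivity)

lemma tensorVec_add_left (a b c : Plane) :
    tensorVec (a + b) c = tensorVec a c + tensorVec b c := by
  ext p
  simp [tensorVec, add_mul]

lemma tensorVec_add_right (a b c : Plane) :
    tensorVec a (b + c) = tensorVec a b + tensorVec a c := by
  ext p
  simp [tensorVec, mul_add]

lemma tensorVec_smul_left (r : ℝ) (a b : Plane) :
    tensorVec (r • a) b = r • tensorVec a b := by
  ext p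
  simp [tensorVec, mul_assoc]

lemma tensorVec_smul_right (r : ℝ) (a b : Plane) :
    tensorVec a (r • b) = r • tensorVec a b := by
  ext p
  simp [tensorVec, mul_left_comm]

lemma tensorL2_add_left (u₁ u₂ w : hydroV 𝒪) :
    tensorL2 (u₁ + u₂) w = tensorL2 u₁ w + tensorL2 u₂ w := by
  refine Lp.ext ?_
  filter_upwards [coeFn_tensorL2 (u₁ + u₂) w, coeFn_tensorL2 u₁ w, coeFn_tensorL2 u₂ w,
    Lp.coeFn_add (tensorL2 u₁ w) (tensorL2 u₂ w),
    Lp.coeFn_add (fieldL 𝒪 u₁) (fieldL 𝒪 u₂)] with x h1 h2 h3 h4 h5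
  rw [h4, h1, Pi.add_apply, h2, h3, map_add, h5, Pi.add_apply, tensorVec_add_left]

lemma tensorL2_add_right (u w₁ w₂ : hydroV 𝒪) :
    tensorL2 u (w₁ + w₂) = tensorL2 u w₁ + tensorL2 u w₂ := by
  refine Lp.ext ?_
  filter_upwards [coeFn_tensorL2 u (w₁ + w₂), coeFn_tensorL2 u w₁, coeFn_tensorL2 u w₂,
    Lp.coeFn_add (tensorL2 u w₁) (tensorL2 u w₂),
    Lp.coeFn_add (fieldL 𝒪 w₁) (fieldL 𝒪 w₂)] with x h1 h2 h3 h4 h5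
  rw [h4, h1, Pi.add_apply, h2, h3, map_add, h5, Pi.add_apply, tensorVec_add_right]

lemma tensorL2_smul_left (c : ℝ) (u w : hydroV 𝒪) :
    tensorL2 (c • u) w = c • tensorL2 u w := by
  refine Lp.ext ?_
  filter_upwards [coeFn_tensorL2 (c • u) w, coeFn_tensorL2 u w,
    Lp.coeFn_smul c (tensorL2 u w), Lp.coeFn_smul c (fieldL 𝒪 u)] with x h1 h2 h3 h4
  rw [h3, h1, Pi.smul_apply, h2, map_smul, h4, Pi.smul_apply, tensorVec_smul_left]

lemma tensorL2_smul_right (c : ℝ) (u w : hydroV 𝒪) :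
    tensorL2 u (c • w) = c • tensorL2 u w := by
  refine Lp.ext ?_
  filter_upwards [coeFn_tensorL2 u (c • w), coeFn_tensorL2 u w,
    Lp.coeFn_smul c (tensorL2 u w), Lp.coeFn_smul c (fieldL 𝒪 w)] with x h1 h2 h3 h4
  rw [h3, h1, Pi.smul_apply, h2, map_smul, h4, Pi.smul_apply, tensorVec_smul_right]

/-- The tensor product as a bounded bilinear map `𝕍 × 𝕍 → L²`. -/
def tensorCLM (𝒪 : Set Plane) : hydroV 𝒪 →L[ℝ] hydroV 𝒪 →L[ℝ] MatrixL2 𝒪 :=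
  LinearMap.mkContinuous₂ (LinearMap.mk₂ ℝ (tensorL2 (𝒪 := 𝒪)) tensorL2_add_left
    tensorL2_smul_left tensorL2_add_right tensorL2_smul_right)
    ladyzhenskayaConst norm_tensorL2_le

lemma tensorCLM_apply (u w : hydroV 𝒪) : tensorCLM 𝒪 u w = tensorL2 u w := rfl

/-- Every entry is dominated by `|u ⊗ w| |∇v|`, hence integrable; this is what permits exchanging
the finite sums with the integral. -/
theorem trilinearForm_eq_inner (u v w : hydroV 𝒪) :
    trilinearForm u v w = inner ℝ (tensorCLM 𝒪 u w) (gradL 𝒪 v) := by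
  have hint : ∀ i j : Fin 2, Integrable
      (fun x => u.1.fst x i * v.1.snd x (i, j) * w.1.fst x j) (volume.restrict 𝒪) := by
    intro i j
    have h1 : Integrable (fun x => ‖tensorL2 u w x‖ * ‖gradL 𝒪 v x‖) (volume.restrict 𝒪) :=
      MemLp.integrable_mul (Lp.memLp _).norm (Lp.memLp _).norm
    have hc : ∀ k : Fin 2, ∀ f : VectorL2 𝒪,
        AEStronglyMeasurable (fun x => f x k) (volume.restrict 𝒪) := fun k f =>
      (show Continuous fun a : Plane => a k by fun_prop).comp_aestronglyMeasurable
        (Lp.aestronglyMeasurable f)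
    refine h1.mono' ?_ ?_
    · refine ((hc i _).mul ?_).mul (hc j _)
      exact (show Continuous fun a : EuclideanSpace ℝ (Fin 2 × Fin 2) => a (i, j) by
        fun_prop).comp_aestronglyMeasurable (Lp.aestronglyMeasurable _)
    · filter_upwards [coeFn_tensorL2 u w] with x hx
      rw [hx]
      have k1 := PiLp.norm_apply_le (tensorVec (fieldL 𝒪 u x) (fieldL 𝒪 w x)) (i, j)
      have k2 := PiLp.norm_apply_le (gradL 𝒪 v x) (i, j)
      have k3 := mul_le_mul k1 k2 (norm_nonneg _) (norm_nonneg _)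
      refine le_trans (le_of_eq ?_) k3
      rw [← norm_mul]
      congr 1
      change _ = fieldL 𝒪 u x i * fieldL 𝒪 w x j * _
      rw [fieldL_apply, fieldL_apply, gradL_apply]
      ring
  rw [trilinearForm, tensorCLM_apply, L2.inner_def]
  simp_rw [← integral_finsetSum _ fun j _ => hint _ j]
  rw [← integral_finsetSum _ fun i _ => integrable_finsetSum _ fun j _ => hint i j]
  refine integral_congr_ae ?_
  filter_upwards [coeFn_tensorL2 u w] with x hx
  rw [hx, PiLp.inner_apply, Fintype.sum_prod_type]
  refine Finset.sum_congr rfl fun i _ => Finset.sum_congr rfl fun j _ => ?_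
  change _ = _ * (fieldL 𝒪 u x i * fieldL 𝒪 w x j)
  rw [fieldL_apply, fieldL_apply, gradL_apply]
  simp
  ring

end Spaces

/-! ### Antisymmetry of the trilinear form and the shift to initial time zero -/

lemma measurePreserving_add_right_Icc (τ T : ℝ) :
    MeasurePreserving (fun s : ℝ => s + τ) (volume.restrict (Icc 0 T))
      (volume.restrict (Icc τ (T + τ))) := by
  simpa using (measurePreserving_add_right (volume : Measure ℝ) τ).restrict_preimage
    (measurableSet_Icc (a := τ) (b := T + τ))

section Convective

variable {𝒪 : Set Plane} {φ ψ : Plane → Plane}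

lemma fderiv_apply_coord (hφ : Differentiable ℝ φ) (i j : Fin 2) (x : Plane) :
    fderiv ℝ (fun y => φ y j) x (EuclideanSpace.single i 1) = planePartial φ i j x := by
  have h := ((EuclideanSpace.proj (𝕜 := ℝ) j).hasFDerivAt (x := φ x)).comp x (hφ x).hasFDerivAt
  have h' : fderiv ℝ (fun y => φ y j) x = (EuclideanSpace.proj (𝕜 := ℝ) j).comp (fderiv ℝ φ x) :=
    h.fderiv
  rw [h']
  rfl

lemma two_mul_inner_tensorVec_planeGrad (hψ : Differentiable ℝ ψ) (a : Plane) (x : Plane) :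
    2 * inner ℝ (tensorVec a (ψ x)) (planeGrad ψ x) =
      ∑ i, a i * fderiv ℝ (fun y => ‖ψ y‖ ^ 2) x (EuclideanSpace.single i 1) := by
  rw [((hψ x).hasFDerivAt.norm_sq).fderiv, PiLp.inner_apply, Fintype.sum_prod_type,
    Finset.mul_sum]
  refine Finset.sum_congr rfl fun i _ => ?_
  simp [tensorVec, planeGrad, planePartial, PiLp.inner_apply]
  ring

/-- Twice the integrand is `φ · ∇|ψ|²`. Integrating by parts over the whole plane gives `-∫ (div φ)
|ψ|² = 0`; compact supports leave no boundary term. -/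
lemma integral_inner_tensorVec_planeGrad (hφ : φ ∈ divFreeTestFields 𝒪)
    (hψ : ψ ∈ divFreeTestFields 𝒪) :
    ∫ x in 𝒪, inner ℝ (tensorVec (φ x) (ψ x)) (planeGrad ψ x) = 0 := by
  have dφ := differentiable_of_mem_divFreeTestFields hφ
  have dψ := differentiable_of_mem_divFreeTestFields hψ
  rw [setIntegral_eq_integral_of_forall_compl_eq_zero fun x hx => by
    rw [planeGrad_eq_zero_of_notMem_tsupport fun h => hx (hψ.2.2.1 h), inner_zero_right]]
  set q : Plane → ℝ := fun y => ‖ψ y‖ ^ 2 with hq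
  have cq : ContDiff ℝ 1 q := (hψ.1.of_le (by simp)).norm_sq ℝ
  have cφ := hφ.1.continuous
  have hsupp : ∀ i : Fin 2, HasCompactSupport fun x => φ x i := fun i =>
    hφ.2.1.comp_left (g := fun a : Plane => a i) rfl
  have hcont : ∀ i : Fin 2, Continuous fun x => φ x i := fun i => by fun_prop
  have hdq : ∀ i : Fin 2, Continuous fun x => fderiv ℝ q x (EuclideanSpace.single i 1) :=
    fun i => (cq.continuous_fderiv (by simp)).clm_apply continuous_const
  have hint : ∀ i : Fin 2, Integrable
      (fun x => φ x i * fderiv ℝ q x (EuclideanSpace.single i 1)) volume := fun i =>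
    ((hcont i).mul (hdq i)).integrable_of_hasCompactSupport ((hsupp i).mul_right)
  have hdsupp : ∀ i : Fin 2, HasCompactSupport fun x => planePartial φ i i x := fun i => by
    have := (hsupp i).fderiv_apply ℝ (EuclideanSpace.single i 1)
    simpa only [fderiv_apply_coord dφ] using this
  have hint2 : ∀ i : Fin 2, Integrable (fun x => planePartial φ i i x * q x) volume := fun i =>
    ((continuous_planePartial hφ i i).mul cq.continuous).integrable_of_hasCompactSupport
      (hdsupp i).mul_right
  have hparts : ∀ i : Fin 2, ∫ x, φ x i * fderiv ℝ q x (EuclideanSpace.single i 1) =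
      -∫ x, planePartial φ i i x * q x := by
    intro i
    rw [integral_mul_fderiv_eq_neg_fderiv_mul_of_integrable]
    · simp only [fderiv_apply_coord dφ]
    · simpa only [fderiv_apply_coord dφ] using hint2 i
    · exact hint i
    · exact ((hcont i).mul cq.continuous).integrable_of_hasCompactSupport (hsupp i).mul_right
    · exact fun x _ => ((EuclideanSpace.proj (𝕜 := ℝ) i).differentiableAt).comp x (dφ x)
    · exact fun x _ => cq.differentiable (by simp) x
  have h2 : 2 * ∫ x, inner ℝ (tensorVec (φ x) (ψ x)) (planeGrad ψ x) = 0 := by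
    rw [← integral_const_mul]
    simp_rw [two_mul_inner_tensorVec_planeGrad dψ]
    rw [integral_finsetSum _ fun i _ => hint i]
    simp_rw [hparts]
    rw [Finset.sum_neg_distrib, ← integral_finsetSum _ fun i _ => hint2 i]
    simp_rw [← Finset.sum_mul, hφ.2.2.2]
    simp
  linarith

/-- The form is continuous on `𝕍` in both arguments, so the cancellation passes from test fields to
the limit. -/
theorem inner_tensorCLM_gradL_self (u v : hydroV 𝒪) :
    inner ℝ (tensorCLM 𝒪 u v) (gradL 𝒪 v) = 0 := by
  obtain ⟨U, φ, hφ, hU⟩ := exists_seq_testField u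
  obtain ⟨W, ψ, hψ, hW⟩ := exists_seq_testField v
  have hc : Continuous fun p : hydroV 𝒪 × hydroV 𝒪 =>
      inner ℝ (tensorCLM 𝒪 p.1 p.2) (gradL 𝒪 p.2) := by fun_prop
  have hlim := (hc.tendsto (u, v)).comp (hU.prodMk_nhds hW)
  refine tendsto_nhds_unique (hlim.congr fun n => ?_) tendsto_const_nhds
  obtain ⟨h1, h2, _⟩ := hφ n
  obtain ⟨k1, k2, k3⟩ := hψ n
  rw [Function.comp_apply, tensorCLM_apply, L2.inner_def,
    ← integral_inner_tensorVec_planeGrad h1 k1]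
  refine integral_congr_ae ?_
  filter_upwards [coeFn_tensorL2 (U n) (W n), h2, k2, k3] with x e1 e2 e3 e4
  rw [e1, gradL_apply, fieldL_apply, fieldL_apply, e2, e3, e4]

theorem isConvective_tensorCLM (𝒪 : Set Plane) :
    IsConvective (fieldL 𝒪) (gradL 𝒪) (tensorCLM 𝒪) ladyzhenskayaConst where
  nonneg := NNReal.coe_nonneg _
  norm_self_le := norm_tensorL2_self_le
  inner_self := inner_tensorCLM_gradL_self

/-- A weak solution that starts at time `τ`, moved to the initial time `0`. -/
theorem IsWeakSolution.exists_isWeakSolutionOn {ν σ τ T : ℝ} {f : ℝ → hydroH 𝒪}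
    {ω ω' : WienerPath} {v₀ : hydroH 𝒪} {v : ℝ → hydroH 𝒪} (hv : IsWeakSolution ν σ f τ ω' v₀ v)
    (hω : ∀ s, wienerShift (s + τ) ω' = wienerShift s ω) :
    ∃ Y, IsWeakSolutionOn (fieldL 𝒪) (gradL 𝒪) (tensorCLM 𝒪) ν σ
      (fun t => ouVariable σ (wienerShift t ω)) (fun s => (f (s + τ) : VectorL2 𝒪)) T
      (fun s => (v (max s 0 + τ) : VectorL2 𝒪)) Y := by
  obtain ⟨hc, h0, V, hV, hae, heq⟩ := hv
  -- The field `v` is controlled only from time `τ` on; `max s 0` freezes it before, giving a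
  -- function continuous on all of `ℝ`.
  refine ⟨fun s => V (s + τ), ?_, ?_, ?_, ?_⟩
  · exact continuous_subtype_val.comp
      (hc.comp_continuous (by fun_prop) fun s => by simp)
  · exact (hV (T + τ)).comp_measurePreserving (measurePreserving_add_right_Icc τ T)
  · have h1 := (measurePreserving_add_right_Icc τ T).quasiMeasurePreserving.ae
      (ae_mono (Measure.restrict_mono Icc_subset_Ici_self le_rfl) hae)
    filter_upwards [h1, ae_restrict_mem measurableSet_Icc] with s hs hsT
    rw [fieldL_apply, hs, max_eq_left hsT.1]
  · intro φ t ht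
    have h := heq φ (t + τ) (by linarith [ht.1])
    simp only [max_eq_left ht.1, max_self, zero_add]
    rw [fieldL_apply, h, h0]
    congr 1
    have hshift := intervalIntegral.integral_comp_add_right (a := 0) (b := t) (fun s =>
      (-(ν * inner ℝ (V s).1.snd φ.1.snd)
        - Real.exp (ouVariable σ (wienerShift s ω')) * trilinearForm (V s) (V s) φ
        + Real.exp (-ouVariable σ (wienerShift s ω')) * inner ℝ (f s : VectorL2 𝒪) φ.1.fst
        + σ * ouVariable σ (wienerShift s ω') * inner ℝ (v s : VectorL2 𝒪) φ.1.fst)) τ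
    rw [zero_add] at hshift
    rw [← hshift]
    refine intervalIntegral.integral_congr fun s hs => ?_
    rw [uIcc_of_le ht.1] at hs
    simp only [hω, trilinearForm_eq_inner, max_eq_left hs.1]
    rfl

end Convective

/-! ### Convergence of the forces and conclusion -/

lemma tendsto_integral_norm_sq_translate {E : Type*} [NormedAddCommGroup E] {f : ℝ → E} {c : E}
    (hf : ∀ a b : ℝ, MemLp f 2 (volume.restrict (Icc a b)))
    (hlim : Tendsto (fun τ : ℝ => ∫⁻ t in Iic τ, ‖f t - c‖ₑ ^ 2) atBot (𝓝 0))
    {T : ℝ} (hT : 0 ≤ T) :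
    Tendsto (fun τ : ℝ => ∫ s in (0 : ℝ)..T, ‖f (s + τ) - c‖ ^ 2) atBot (𝓝 0) := by
  have hl : Tendsto (fun τ : ℝ => ∫⁻ t in Iic (T + τ), ‖f t - c‖ₑ ^ 2) atBot (𝓝 0) :=
    hlim.comp (tendsto_atBot_add_const_left _ T tendsto_id)
  have hl' := (ENNReal.tendsto_toReal (by simp)).comp hl
  refine squeeze_zero' (Eventually.of_forall fun τ =>
    intervalIntegral.integral_nonneg hT fun _ _ => by positivity) ?_ hl'
  -- The window `(τ, T + τ]` lies in the tail `(-∞, T + τ]`. Finiteness of the tail is needed to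
  -- compare real values, because `toReal` sends `∞` to `0`.
  filter_upwards [hl.eventually (gt_mem_nhds one_pos)] with τ hτ
  rw [intervalIntegral.integral_comp_add_right (fun s => ‖f s - c‖ ^ 2), zero_add,
    intervalIntegral.integral_of_le (by linarith),
    integral_eq_lintegral_of_nonneg_ae (Eventually.of_forall fun _ => by positivity)]
  · refine ENNReal.toReal_mono (hτ.trans ENNReal.one_lt_top).ne ?_
    refine (lintegral_mono_set Ioc_subset_Iic_self).trans_eq (lintegral_congr fun s => ?_)
    rw [ENNReal.ofReal_pow (norm_nonneg _), ofReal_norm]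
  · have h := ((hf τ (T + τ)).1.mono_measure
      (Measure.restrict_mono Ioc_subset_Icc_self le_rfl)).sub
      (aestronglyMeasurable_const (b := c))
    exact h.norm.pow 2

end

theorem proposition3p4 (𝒪 : Set Plane) (h𝒪 : IsOpen 𝒪) (h𝒪b : Bornology.IsBounded 𝒪)
    (ν σ : ℝ) (hν : 0 < ν) (hσ : 0 < σ)
    (f : ℝ → hydroH 𝒪) (hf : ∀ a b : ℝ, MemLp f 2 (volume.restrict (Icc a b)))
    (fInf : hydroH 𝒪)
    (hlim : Tendsto (fun τ : ℝ => ∫⁻ t in Iic τ, ‖f t - fInf‖ₑ ^ 2) atBot (𝓝 0)) :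
    -- the paths `ω` considered form a shift-invariant set of full Wiener measure
    (∀ P : Measure WienerPath, IsTwoSidedWienerMeasure P → ∀ᵐ ω ∂P, ω ∈ ouPaths σ) ∧
    (∀ t : ℝ, ∀ ω ∈ ouPaths σ, wienerShift t ω ∈ ouPaths σ) ∧
    -- backward convergence for every such path
    ∀ ω ∈ ouPaths σ, ∀ (vInit : ℝ → hydroH 𝒪) (vtInit : hydroH 𝒪),
      Tendsto (fun τ => ‖vInit τ - vtInit‖) atBot (𝓝 0) →
      ∀ (v : ℝ → ℝ → hydroH 𝒪) (vt : ℝ → hydroH 𝒪),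
        (∀ τ : ℝ, IsWeakSolution ν σ f τ (wienerShift (-τ) ω) (vInit τ) (v τ)) →
        IsWeakSolution ν σ (fun _ => fInf) 0 ω vtInit vt →
        ∀ T : ℝ, 0 < T → Tendsto (fun τ => ‖v τ (T + τ) - vt T‖) atBot (𝓝 0) := by
  refine ⟨fun P hP => ae_mem_ouPaths hσ hP, fun t ω hω => wienerShift_mem_ouPaths hσ t hω, ?_⟩
  intro ω hω vInit vtInit hInit v vt hv hvt T hT
  obtain ⟨Yt, hYt⟩ := hvt.exists_isWeakSolutionOn (T := T) (ω := ω) (fun s => by rw [add_zero])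
  -- The shift by `τ` cancels the shift `-τ` of the path, so for every `τ` the coefficients are
  -- those of the limit problem.
  choose Y hY using fun τ => (hv τ).exists_isWeakSolutionOn (T := T) (ω := ω) (fun s => by
    rw [wienerShift_wienerShift, add_neg_cancel_right])
  obtain ⟨K, hK⟩ := IsWeakSolutionOn.exists_stability_const (isConvective_tensorCLM 𝒪) hν hσ hT.le
    (continuous_ouVariable_wienerShift hσ hω) (memLp_const _) hYt
  have hmem : ∀ τ : ℝ,
      MemLp (fun s => (f (s + τ) : VectorL2 𝒪)) 2 (volume.restrict (Icc 0 T)) := by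
    intro τ
    exact (hydroH 𝒪).subtypeL.comp_memLp' ((hf τ (T + τ)).comp_measurePreserving (measurePreserving_add_right_Icc τ T))
  have hbound : ∀ τ : ℝ, ‖v τ (T + τ) - vt T‖ ^ 2 ≤
      K * (‖vInit τ - vtInit‖ ^ 2 + ∫ s in (0 : ℝ)..T, ‖f (s + τ) - fInf‖ ^ 2) := by
    intro τ
    have h := hK _ _ _ (hmem τ) (hY τ)
    simp only [max_eq_left hT.le, max_self, zero_add, add_zero, (hv τ).2.1, hvt.2.1] at h
    exact h
  have hR : Tendsto (fun τ : ℝ =>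
      K * (‖vInit τ - vtInit‖ ^ 2 + ∫ s in (0 : ℝ)..T, ‖f (s + τ) - fInf‖ ^ 2)) atBot (𝓝 0) := by
    have h := ((hInit.pow 2).add (tendsto_integral_norm_sq_translate hf hlim hT.le)).const_mul K
    simpa using h
  have hsq : Tendsto (fun τ => ‖v τ (T + τ) - vt T‖ ^ 2) atBot (𝓝 0) :=
    squeeze_zero (fun τ => by positivity) hbound hR
  simpa [Real.sqrt_sq (norm_nonneg _)] using hsq.sqrt
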